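/- Let $K$ be a field, $R=K[x_1,\dots,x_n]$ with a monomial order $<$, and let $f_1,\dots,f_m\in R$ be homogeneous polynomials forming a regular sequence ($f_i$ is a non-zero-divisor on $R/\langle f_1,\dots,f_{i-1}\rangle$ for $i=1,\dots,m$, and $\langle f_1,\dots,f_m\rangle\ne R$). For $\alpha=\sum a_i e_i\in R^m$ put $\bar\alpha=\sum a_if_i$; $\alpha$ is a syzygy if $\bar\alpha=0$. Order module monomials by $a e_i<_{\mathrm{d\text{-}pot}} b e_j$ iff $\deg(\overline{ae_i})<\deg(\overline{be_j})$, or these degrees are equal and either $i<j$, or $i=j$ and $a<b$. For $\alpha\neq 0$ the signature $\mathrm{sig}(\alpha)$ is the largest term of $\alpha$; if it is a multiple of $e_i$, then $i$ is the index of $\alpha$. Signatures are compared and divided up to non-zero scalars. The S-pair of $\alpha,\beta$ (with $\bar\alpha,\bar\beta\ne0$) is $\frac{\lambda}{\mathrm{lt}(\bar\alpha)}\alpha-\frac{\lambda}{\mathrm{lt}(\bar\beta)}\beta$, $\lambda=\mathrm{lcm}(\mathrm{lt}(\bar\alpha),\mathrm{lt}(\bar\beta))$; the two summands (up to sign) are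 its generators, and it is regular if their signatures differ. A regular s-reduction step of $\alpha$ by $\beta\in G$ replaces $\alpha$ by $\alpha-b\beta$, where $b$ is a monomial such that $\mathrm{lt}(\overline{b\beta})$ is a term of $\bar\alpha$ and $\mathrm{sig}(b\beta)<\mathrm{sig}(\alpha)$. A result of regular s-reducing $\alpha$ is an element reached from $\alpha$ by such steps that admits no further one. Algorithm RB starts with $G=\emptyset$, $H=\{f_ie_j-f_je_i: i<j\}$, $P=\{e_1,\dots,e_m\}$ and proceeds as follows, as long as $P\neq\emptyset$. (a) Whenever the degree $\deg(\overline{T})$ of the minimal signature $T$ in $P$ exceeds the degree treated so far, a new degree step starts, and the Koszul syzygies $\bar\alpha e_k-f_k\alpha$, for all $\alpha\in G$ and all $k$ larger than the index of $\alpha$, are added to $H$. (b) An element $p$ of $P$ of minimal signature (ties broken arbitrarily) is removed from $P$. It is discarded if it is rewritable. Otherwise it is regular s-reduced with respect to $G$ to a result $\gamma$. If $\bar\gamma=0$, then $\gamma$ is added to $H$; otherwise the regular S-pairs of $\gamma$ with the elements of $G$ are added to $P$, and $\gamma$ is added to $G$. Here an S-pair is rewritable if one of its two generators $a\alpha$ is,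 which means that there is $\gamma\in G\cup H$, $\gamma\neq\alpha$, with $\mathrm{sig}(\gamma)\mid\mathrm{sig}(a\alpha)$ and $\alpha\trianglelefteq\gamma$; a unit vector $e_i$ is rewritable if $\mathrm{sig}(\gamma)\mid e_i$ for some $\gamma\in G\cup H$. The rewrite order $\trianglelefteq$ is a partial order on $G\cup H$, total on $G$, fixed during the computation, such that $\alpha\trianglelefteq\sigma$ for $\alpha\in G$, $\sigma\in H$, and such that $\alpha\trianglelefteq\beta$ whenever $\alpha,\beta\in G$, $\mathrm{sig}(\alpha)$ properly divides $\mathrm{sig}(\beta)$, and $\mathrm{sig}(\alpha)\,\mathrm{lt}(\bar\beta)\le\mathrm{sig}(\beta)\,\mathrm{lt}(\bar\alpha)$ (these are then multiples of the same $e_i$ and are compared by $<$ on the coefficient monomials). Both usual rewrite orders, $\trianglelefteq_{\mathrm{add}}$ (later added elements are larger) and $\trianglelefteq_{\mathrm{rat}}$ (larger ratio $\mathrm{sig}(\alpha)/\mathrm{lt}(\bar\alpha)$, ties by signature), are of this kind. Then RB performs no s-reduction to zero: at every point of every such computation, for every element of $P$ that is chosen and not discarded, every result $\gamma$ of its regular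 s-reduction satisfies $\bar\gamma\neq0$. -/

import Mathlib

open scoped MonomialOrder

namespace SigGB

variable {K : Type*} [Field K] {n m : ℕ}

/-- Monic module monomials `x^a e_i` of the free module `K[x_1,…,x_n]^m`, as pairs `(i, a)`. -/
abbrev ModMon (n m : ℕ) : Type := Fin m × (Fin n →₀ ℕ)

/-- The free module `K[x_1,…,x_n]^m`. -/
abbrev FreeMod (K : Type*) [Field K] (n m : ℕ) : Type _ := Fin m → MvPolynomial (Fin n) K

/-- The unit vector `e_i`. -/
noncomputable def unitVec (i : Fin m) : FreeMod K n m := Pi.single i 1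

/-- The homomorphism `α ↦ ᾱ`, sending `e_i` to `f_i`. -/
noncomputable def proj (f : Fin m → MvPolynomial (Fin n) K) (α : FreeMod K n m) :
    MvPolynomial (Fin n) K := ∑ i, α i * f i

/-- `T` divides `U`, as module monomials. -/
def ModDvd (T U : ModMon n m) : Prop := T.1 = U.1 ∧ T.2 ≤ U.2

/-- The degree of the image in the polynomial ring of the module monomial `x^a e_i`. -/
noncomputable def sigDegree (f : Fin m → MvPolynomial (Fin n) K) (T : ModMon n m) : ℕ :=
  (proj f (MvPolynomial.monomial T.2 (1 : K) • unitVec T.1)).totalDegree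

/-- The position-over-term order. -/
def PotLT (mo : MonomialOrder (Fin n)) (T U : ModMon n m) : Prop :=
  T.1 < U.1 ∨ (T.1 = U.1 ∧ T.2 ≺[mo] U.2)

/-- The degree-then-position order: compare the degrees of the images, break ties by `PotLT`. -/
def DPotLT (mo : MonomialOrder (Fin n)) (f : Fin m → MvPolynomial (Fin n) K)
    (T U : ModMon n m) : Prop :=
  sigDegree f T < sigDegree f U ∨ (sigDegree f T = sigDegree f U ∧ PotLT mo T U)

/-- `T` is the signature of `α` (up to its coefficient): the largest module monomial that
occurs in `α`. An element has a signature iff it is nonzero. -/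
def HasSig (mo : MonomialOrder (Fin n)) (f : Fin m → MvPolynomial (Fin n) K)
    (α : FreeMod K n m) (T : ModMon n m) : Prop :=
  (α T.1).coeff T.2 ≠ 0 ∧
    ∀ U : ModMon n m, (α U.1).coeff U.2 ≠ 0 → U ≠ T → DPotLT mo f U T

/-- One regular s-reduction step with respect to `G`: some term of `ᾱ`, with exponent `v`, is
the lead term of the image of `b β`, where `b = c x^w` is a nonzero monomial, `β ∈ G`, and the
signature of `b β` is smaller than that of `α`. The outcome is `α - b β`. -/
def RegularStep (mo : MonomialOrder (Fin n)) (f : Fin m → MvPolynomial (Fin n) K)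
    (G : Set (FreeMod K n m)) (α α' : FreeMod K n m) : Prop :=
  ∃ β ∈ G, ∃ (w : Fin n →₀ ℕ) (c : K), c ≠ 0 ∧
    (∃ v ∈ (proj f α).support,
      mo.leadingTerm (proj f (MvPolynomial.monomial w c • β)) =
        MvPolynomial.monomial v ((proj f α).coeff v)) ∧
    (∃ S T : ModMon n m, HasSig mo f (MvPolynomial.monomial w c • β) S ∧ HasSig mo f α T ∧
      DPotLT mo f S T) ∧
    α' = α - MvPolynomial.monomial w c • β

/-- `γ` is a result of regular s-reducing `α` with respect to `G`. -/
def RegularResult (mo : MonomialOrder (Fin n)) (f : Fin m → MvPolynomial (Fin n) K)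
    (G : Set (FreeMod K n m)) (α γ : FreeMod K n m) : Prop :=
  Relation.ReflTransGen (RegularStep mo f G) α γ ∧ ¬ ∃ δ, RegularStep mo f G γ δ

/-- The monomial `λ / lt(ᾱ)`, where `λ` is the monic least common multiple of the lead terms of
`ᾱ` and of the image of `β`. -/
noncomputable def cofactor (mo : MonomialOrder (Fin n)) (f : Fin m → MvPolynomial (Fin n) K)
    (α β : FreeMod K n m) : MvPolynomial (Fin n) K :=
  MvPolynomial.monomial
    ((mo.degree (proj f α) ⊔ mo.degree (proj f β)) - mo.degree (proj f α))
    (mo.leadingCoeff (proj f α))⁻¹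

/-- The S-pair of `α` and `β` is regular: its two generators have different signatures. -/
def IsRegularPair (mo : MonomialOrder (Fin n)) (f : Fin m → MvPolynomial (Fin n) K)
    (α β : FreeMod K n m) : Prop :=
  ∃ S T : ModMon n m, HasSig mo f (cofactor mo f α β • α) S ∧
    HasSig mo f (cofactor mo f β α • β) T ∧ S ≠ T

/-- Members of the pair set: the unit vectors `e_i`, and the S-pairs. -/
inductive Pair (K : Type*) [Field K] (n m : ℕ) : Type _
  | unit (i : Fin m) : Pair K n m
  | spair (α β : FreeMod K n m) : Pair K n m

/-- The module element that a member of the pair set stands for. -/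
noncomputable def Pair.value (mo : MonomialOrder (Fin n)) (f : Fin m → MvPolynomial (Fin n) K) :
    Pair K n m → FreeMod K n m
  | .unit i => unitVec i
  | .spair α β => cofactor mo f α β • α - cofactor mo f β α • β

/-- `γ` is a rewriter in signature `T`: its signature divides `T`. -/
def IsRewriter (mo : MonomialOrder (Fin n)) (f : Fin m → MvPolynomial (Fin n) K)
    (γ : FreeMod K n m) (T : ModMon n m) : Prop :=
  ∃ S, HasSig mo f γ S ∧ ModDvd S T

/-- The multiple of `α ∈ G` whose signature is `T` is rewritable: `α` is not the maximal rewriter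
in signature `T`, with respect to the rewrite order `le` on `G ∪ H`. -/
def Rewritable (mo : MonomialOrder (Fin n)) (f : Fin m → MvPolynomial (Fin n) K)
    (le : FreeMod K n m → FreeMod K n m → Prop) (G H : Set (FreeMod K n m))
    (α : FreeMod K n m) (T : ModMon n m) : Prop :=
  ∃ γ ∈ G ∪ H, γ ≠ α ∧ le α γ ∧ IsRewriter mo f γ T

/-- The rewritability check. An S-pair is rewritable if one of its two generators is; a unit
vector is rewritable if `G ∪ H` already contains a rewriter in its signature. -/
def Pair.IsRewritable (mo : MonomialOrder (Fin n)) (f : Fin m → MvPolynomial (Fin n) K)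
    (le : FreeMod K n m → FreeMod K n m → Prop) (G H : Set (FreeMod K n m)) :
    Pair K n m → Prop
  | .unit i => ∃ γ ∈ G ∪ H, IsRewriter mo f γ (i, 0)
  | .spair α β =>
      (∃ S, HasSig mo f (cofactor mo f α β • α) S ∧ Rewritable mo f le G H α S) ∨
      (∃ S, HasSig mo f (cofactor mo f β α • β) S ∧ Rewritable mo f le G H β S)

/-- A state of RB: the basis `G`, the known syzygies `H`, the pair set `P`, and the degree step
`deg` that has been reached. -/
structure State (K : Type*) [Field K] (n m : ℕ) where
  G : Set (FreeMod K n m)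
  H : Set (FreeMod K n m)
  P : Set (Pair K n m)
  deg : ℕ

/-- The initial state: `G` is empty, `H` consists of the Koszul syzygies of the input, and `P` of
the unit vectors. -/
def initState (f : Fin m → MvPolynomial (Fin n) K) : State K n m where
  G := ∅
  H := {σ | ∃ i j : Fin m, i < j ∧ σ = f i • unitVec j - f j • unitVec i}
  P := Set.range Pair.unit
  deg := 0

/-- The Koszul syzygies `ᾱ e_k - f_k α` between the elements `α` of `G` and the unit vectors
`e_k` of index `k` larger than the index of `α`. -/
def basisKoszul (mo : MonomialOrder (Fin n)) (f : Fin m → MvPolynomial (Fin n) K)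
    (G : Set (FreeMod K n m)) : Set (FreeMod K n m) :=
  {σ | ∃ α ∈ G, ∃ S : ModMon n m, HasSig mo f α S ∧ ∃ k : Fin m, S.1 < k ∧
    σ = proj f α • unitVec k - f k • α}

/-- `p` is a member of minimal signature, namely `T`, of the pair set. -/
def IsNext (mo : MonomialOrder (Fin n)) (f : Fin m → MvPolynomial (Fin n) K)
    (s : State K n m) (p : Pair K n m) (T : ModMon n m) : Prop :=
  p ∈ s.P ∧ HasSig mo f (p.value mo f) T ∧
    ∀ q ∈ s.P, ∀ U, HasSig mo f (q.value mo f) U → ¬ DPotLT mo f U T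

/-- In state `s`, RB takes `p` out of the pair set, finds it not rewritable and regular s-reduces
it, with result `γ`. -/
def Reduces (mo : MonomialOrder (Fin n)) (f : Fin m → MvPolynomial (Fin n) K)
    (le : FreeMod K n m → FreeMod K n m → Prop) (s : State K n m)
    (p : Pair K n m) (γ : FreeMod K n m) : Prop :=
  (∃ T, IsNext mo f s p T ∧ sigDegree f T ≤ s.deg) ∧
    ¬ p.IsRewritable mo f le s.G s.H ∧ RegularResult mo f s.G (p.value mo f) γ

/-- The steps of RB. When the minimal signature in the pair set has a degree beyond the current
one, a new degree step starts and the Koszul syzygies of the current basis are added to `H`.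
Otherwise a pair of minimal signature is discarded, or reduced and its result added to `H` or to
`G`; in the last case its regular S-pairs with the elements of `G` are added to the pair set. -/
inductive Step (mo : MonomialOrder (Fin n)) (f : Fin m → MvPolynomial (Fin n) K)
    (le : FreeMod K n m → FreeMod K n m → Prop) : State K n m → State K n m → Prop
  | newDegree (s : State K n m) (p : Pair K n m) (T : ModMon n m)
      (hp : IsNext mo f s p T) (hd : s.deg < sigDegree f T) :
      Step mo f le s { s with H := s.H ∪ basisKoszul mo f s.G, deg := sigDegree f T }
  | discard (s : State K n m) (p : Pair K n m) (T : ModMon n m)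
      (hp : IsNext mo f s p T) (hd : sigDegree f T ≤ s.deg)
      (hr : p.IsRewritable mo f le s.G s.H) :
      Step mo f le s { s with P := s.P \ {p} }
  | syzygy (s : State K n m) (p : Pair K n m) (γ : FreeMod K n m)
      (hp : Reduces mo f le s p γ) (h0 : proj f γ = 0) :
      Step mo f le s { s with P := s.P \ {p}, H := s.H ∪ {γ} }
  | basis (s : State K n m) (p : Pair K n m) (γ : FreeMod K n m)
      (hp : Reduces mo f le s p γ) (h0 : proj f γ ≠ 0) :
      Step mo f le s
        { s with
          P := (s.P \ {p}) ∪ {q | ∃ α ∈ s.G, IsRegularPair mo f α γ ∧ q = Pair.spair α γ}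
          G := s.G ∪ {γ} }

/-- `le` is a rewrite order on `G ∪ H`: a partial order that is total on `G`. -/
structure IsRewriteOrder (le : FreeMod K n m → FreeMod K n m → Prop)
    (G H : Set (FreeMod K n m)) : Prop where
  refl : ∀ α ∈ G ∪ H, le α α
  antisymm : ∀ α ∈ G ∪ H, ∀ β ∈ G ∪ H, le α β → le β α → α = β
  trans : ∀ α ∈ G ∪ H, ∀ β ∈ G ∪ H, ∀ γ ∈ G ∪ H, le α β → le β γ → le α γ
  total : ∀ α ∈ G, ∀ β ∈ G, le α β ∨ le β α

/-- The rewrite orders that are considered: known syzygies are preferred to basis elements, and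
`β ∈ G` is preferred to `α ∈ G` if the signature `S` of `α` properly divides the signature `T` of
`β` and `S lt(β̄) ≤ T lt(ᾱ)`. Both usual choices are of this kind: to prefer the element that was
added later (signatures being treated in increasing order), and to prefer the element with the
larger ratio of signature and lead term (equal ratios being compared by signature). -/
structure IsAdmissibleOrder (mo : MonomialOrder (Fin n)) (f : Fin m → MvPolynomial (Fin n) K)
    (le : FreeMod K n m → FreeMod K n m → Prop) (G H : Set (FreeMod K n m)) : Prop
    extends IsRewriteOrder le G H where
  le_syzygy : ∀ α ∈ G, ∀ σ ∈ H, le α σ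
  le_of_dvd : ∀ α ∈ G, ∀ β ∈ G, ∀ S T : ModMon n m,
    HasSig mo f α S → HasSig mo f β T → ModDvd S T → S ≠ T →
    S.2 + mo.degree (proj f β) ≼[mo] T.2 + mo.degree (proj f α) → le α β

/-- The states `s 0, …, s N` form an initial segment of a computation of RB on the input `f`,
with the order `DPotLT` and the rewrite order `le`. -/
structure IsRun (mo : MonomialOrder (Fin n)) (f : Fin m → MvPolynomial (Fin n) K)
    (le : FreeMod K n m → FreeMod K n m → Prop) (N : ℕ) (s : ℕ → State K n m) : Prop where
  init : s 0 = initState f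
  step : ∀ i < N, Step mo f le (s i) (s (i + 1))
  order : ∀ i ≤ N, IsAdmissibleOrder mo f le (s i).G (s i).H

end SigGB

namespace SigGB

open MvPolynomial

variable {K : Type*} [Field K] {n m : ℕ} {mo : MonomialOrder (Fin n)}
  {f : Fin m → MvPolynomial (Fin n) K} {le : FreeMod K n m → FreeMod K n m → Prop}

/-! ### The map to the polynomial ring -/

/-! Suppose a reduction ends in `γ` with image zero and signature x^a e_k. All elements that occur
are homogeneous, and within one degree the position decides first; so `γ` lives in positions up to
k, and γ_k has lead monomial x^a. Now γ_k f_k lies in the ideal of the f_i with i < k, hence so does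
γ_k by regularity. Since deg f_k > 0, γ_k is the image of a homogeneous element of degree below the
current one, whose signature is smaller than all pending ones. There `G` is a signature Gröbner
basis (`reducibleAt`), which yields β in `G` of index below k whose image has a lead monomial
dividing x^a. The Koszul syzygy of β and e_k is already in `H`, and its signature lt(β̄) e_k divides
that of `γ` (`hasSig_koszul`). So the pair was rewritable and would have been discarded
(`Invariant.proj_ne_zero_of_reduces`).

That `G` is a signature Gröbner basis below the pending signatures follows by well-founded induction
on the signature, for two claims together: non-rewritable multiples of basis elements are not
regular s-reducible at the lead term (`irreducibleAt_of_treated`), and every element with nonzero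
image is s-reducible at its lead term (`reducibleAt_of_treated`). Both rest on cancelling signatures
(`isMultiple_trichotomy`) and on a loop invariant saying that each S-pair is pending, rewritable or
treated (`IsRun.invariant`). -/

theorem proj_sub (α β : FreeMod K n m) : proj f (α - β) = proj f α - proj f β := by
  simp [proj, sub_mul]

theorem proj_smul (p : MvPolynomial (Fin n) K) (α : FreeMod K n m) :
    proj f (p • α) = p * proj f α := by
  simp [proj, Finset.mul_sum, mul_assoc]

theorem proj_unitVec (i : Fin m) : proj f (unitVec i : FreeMod K n m) = f i := by
  simp [proj, unitVec, Pi.single_apply]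

theorem proj_zero : proj f (0 : FreeMod K n m) = 0 := by simp [proj]

/-! ### The order on module monomials -/

/-- The multiple `x^w T` of a module monomial. -/
noncomputable def shift (w : Fin n →₀ ℕ) (T : ModMon n m) : ModMon n m := (T.1, w + T.2)

theorem shift_add (v w : Fin n →₀ ℕ) (T : ModMon n m) :
    shift (v + w) T = shift v (shift w T) := by
  simp [shift, add_assoc]

theorem modDvd_iff_exists_shift {S T : ModMon n m} : ModDvd S T ↔ ∃ w, T = shift w S := by
  constructor
  · rintro ⟨h1, h2⟩
    refine ⟨T.2 - S.2, Prod.ext h1.symm ?_⟩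
    simp [shift, tsub_add_cancel_of_le h2]
  · rintro ⟨w, rfl⟩
    exact ⟨rfl, by simp [shift]⟩

theorem modDvd_shift (w : Fin n →₀ ℕ) (T : ModMon n m) : ModDvd T (shift w T) :=
  modDvd_iff_exists_shift.2 ⟨w, rfl⟩

theorem ModDvd.trans {S T U : ModMon n m} (h : ModDvd S T) (h' : ModDvd T U) : ModDvd S U :=
  ⟨h.1.trans h'.1, h.2.trans h'.2⟩

theorem sigDegree_eq (hf : ∀ i, f i ≠ 0) (T : ModMon n m) :
    sigDegree f T = T.2.degree + (f T.1).totalDegree := by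
  have h : (monomial T.2 (1 : K)) ≠ 0 := by simp
  rw [sigDegree, proj_smul, proj_unitVec, totalDegree_mul_of_isDomain h (hf _),
    totalDegree_monomial _ one_ne_zero]
  rfl

theorem sigDegree_shift (hf : ∀ i, f i ≠ 0) (w : Fin n →₀ ℕ) (T : ModMon n m) :
    sigDegree f (shift w T) = w.degree + sigDegree f T := by
  simp [sigDegree_eq hf, shift, add_assoc]

variable (mo f) in
/-- An embedding of the module monomials into a well-order that turns `DPotLT` into `<`. -/
noncomputable def key (T : ModMon n m) : ℕ ×ₗ Fin m ×ₗ mo.syn :=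
  toLex (sigDegree f T, toLex (T.1, mo.toSyn T.2))

theorem dPotLT_iff {T U : ModMon n m} : DPotLT mo f T U ↔ key mo f T < key mo f U := by
  simp [DPotLT, PotLT, key, Prod.Lex.toLex_lt_toLex]

theorem key_injective : Function.Injective (key mo f) := by
  rintro ⟨i, a⟩ ⟨j, b⟩ h
  simp only [key, EmbeddingLike.apply_eq_iff_eq, Prod.mk.injEq] at h
  exact Prod.ext h.2.1 h.2.2

theorem sigDegree_le_of_key_le {T U : ModMon n m} (h : key mo f T ≤ key mo f U) :
    sigDegree f T ≤ sigDegree f U := by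
  rcases Prod.Lex.toLex_le_toLex.1 h with h | h
  · exact h.le
  · exact h.1.le

theorem key_shift_lt (hf : ∀ i, f i ≠ 0) (w : Fin n →₀ ℕ) {T U : ModMon n m} :
    key mo f (shift w T) < key mo f (shift w U) ↔ key mo f T < key mo f U := by
  simp only [← dPotLT_iff, DPotLT, PotLT, sigDegree_shift hf]
  simp [shift]

theorem key_shift_le (hf : ∀ i, f i ≠ 0) (w : Fin n →₀ ℕ) {T U : ModMon n m} :
    key mo f (shift w T) ≤ key mo f (shift w U) ↔ key mo f T ≤ key mo f U := by
  rw [← not_lt, key_shift_lt hf, not_lt]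

theorem key_le_shift (hf : ∀ i, f i ≠ 0) (w : Fin n →₀ ℕ) (T : ModMon n m) :
    key mo f T ≤ key mo f (shift w T) := by
  have h : mo.toSyn T.2 ≤ mo.toSyn (w + T.2) := by
    rw [map_add]; exact le_add_of_nonneg_left (mo.zero_le _)
  refine Prod.Lex.toLex_le_toLex.2 ?_
  rw [sigDegree_shift hf]
  rcases Nat.eq_zero_or_pos w.degree with h0 | h0
  · right
    refine ⟨by simp [h0], Prod.Lex.toLex_le_toLex.2 (Or.inr ⟨rfl, h⟩)⟩
  · left
    simpa using h0

/-! ### Signatures -/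

theorem HasSig.ne_zero {α : FreeMod K n m} {T : ModMon n m} (h : HasSig mo f α T) : α ≠ 0 := by
  rintro rfl
  exact h.1 (by simp)

theorem HasSig.key_le {α : FreeMod K n m} {T U : ModMon n m} (h : HasSig mo f α T)
    (hU : (α U.1).coeff U.2 ≠ 0) : key mo f U ≤ key mo f T := by
  by_cases hUT : U = T
  · rw [hUT]
  · exact (dPotLT_iff.1 (h.2 U hU hUT)).le

theorem HasSig.unique {α : FreeMod K n m} {S T : ModMon n m} (hS : HasSig mo f α S)
    (hT : HasSig mo f α T) : S = T :=
  key_injective (le_antisymm (hT.key_le hS.1) (hS.key_le hT.1))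

theorem hasSig_of_key_le {α : FreeMod K n m} {T : ModMon n m} (h0 : (α T.1).coeff T.2 ≠ 0)
    (h : ∀ U : ModMon n m, (α U.1).coeff U.2 ≠ 0 → key mo f U ≤ key mo f T) :
    HasSig mo f α T :=
  ⟨h0, fun U hU hUT => dPotLT_iff.2 (lt_of_le_of_ne (h U hU) fun he => hUT (key_injective he))⟩

variable (mo f) in
theorem exists_hasSig {α : FreeMod K n m} (h : α ≠ 0) : ∃ T, HasSig mo f α T := by
  classical
  let s : Finset (ModMon n m) :=
    Finset.univ.biUnion fun i => (α i).support.map ⟨Prod.mk i, Prod.mk_right_injective i⟩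
  have hs : ∀ U : ModMon n m, U ∈ s ↔ (α U.1).coeff U.2 ≠ 0 := by
    rintro ⟨i, a⟩
    simp [s]
  obtain ⟨i, hi⟩ := Function.ne_iff.1 h
  obtain ⟨a, ha⟩ := MvPolynomial.ne_zero_iff.1 hi
  obtain ⟨T, hT, hmax⟩ := s.exists_max_image (key mo f) ⟨(i, a), (hs _).2 ha⟩
  exact ⟨T, hasSig_of_key_le ((hs T).1 hT) fun U hU => hmax U ((hs U).2 hU)⟩

theorem coeff_monomial_smul_shift (w : Fin n →₀ ℕ) (c : K) (α : FreeMod K n m)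
    (T : ModMon n m) :
    ((monomial w c • α) (shift w T).1).coeff (shift w T).2 = c * (α T.1).coeff T.2 := by
  simp [shift]

theorem exists_shift_of_coeff_ne_zero {w : Fin n →₀ ℕ} {c : K} {α : FreeMod K n m}
    {U : ModMon n m} (h : ((monomial w c • α) U.1).coeff U.2 ≠ 0) :
    ∃ V : ModMon n m, U = shift w V ∧ (α V.1).coeff V.2 ≠ 0 := by
  simp only [Pi.smul_apply, smul_eq_mul, coeff_monomial_mul'] at h
  split_ifs at h with hw
  · refine ⟨(U.1, U.2 - w), Prod.ext rfl ?_, right_ne_zero_of_mul h⟩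
    simp [shift, add_tsub_cancel_of_le hw]
  · exact absurd rfl h

theorem HasSig.monomial_smul (hf : ∀ i, f i ≠ 0) {α : FreeMod K n m} {T : ModMon n m}
    (h : HasSig mo f α T) (w : Fin n →₀ ℕ) {c : K} (hc : c ≠ 0) :
    HasSig mo f (monomial w c • α) (shift w T) := by
  refine hasSig_of_key_le ?_ fun U hU => ?_
  · rw [coeff_monomial_smul_shift]
    exact mul_ne_zero hc h.1
  · obtain ⟨V, rfl, hV⟩ := exists_shift_of_coeff_ne_zero hU
    exact (key_shift_le hf w).2 (h.key_le hV)

theorem HasSig.exists_of_monomial_smul (hf : ∀ i, f i ≠ 0) {α : FreeMod K n m}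
    {T : ModMon n m} {w : Fin n →₀ ℕ} {c : K} (h : HasSig mo f (monomial w c • α) T) :
    ∃ S, HasSig mo f α S ∧ T = shift w S := by
  have hc : c ≠ 0 := by
    rintro rfl
    exact h.ne_zero (by simp)
  have hα : α ≠ 0 := by
    rintro rfl
    exact h.ne_zero (by simp)
  obtain ⟨S, hS⟩ := exists_hasSig mo f hα
  exact ⟨S, hS, h.unique (hS.monomial_smul hf w hc)⟩

theorem HasSig.sub_of_lt {α β : FreeMod K n m} {S T : ModMon n m} (hα : HasSig mo f α T)
    (hβ : HasSig mo f β S) (h : key mo f S < key mo f T) : HasSig mo f (α - β) T := by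
  have h0 : (β T.1).coeff T.2 = 0 := by
    by_contra h0
    exact (hβ.key_le h0).not_gt h
  refine hasSig_of_key_le (by simpa [h0] using hα.1) fun U hU => ?_
  by_cases hU' : (α U.1).coeff U.2 = 0
  · refine (hβ.key_le fun h' => hU ?_).trans h.le
    simp [hU', h']
  · exact hα.key_le hU'

theorem HasSig.neg {α : FreeMod K n m} {T : ModMon n m} (h : HasSig mo f α T) :
    HasSig mo f (-α) T := by
  refine hasSig_of_key_le (by simpa using h.1) fun U hU => h.key_le (by simpa using hU)

/-- Subtracting a multiple of the same signature that cancels the signature. -/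
theorem HasSig.exists_cancel (hf : ∀ i, f i ≠ 0) {α β : FreeMod K n m} {S T : ModMon n m}
    {w : Fin n →₀ ℕ} (hα : HasSig mo f α T) (hβ : HasSig mo f β S) (hT : T = shift w S) :
    ∃ c : K, c ≠ 0 ∧ ∀ U, HasSig mo f (α - monomial w c • β) U → key mo f U < key mo f T := by
  subst hT
  refine ⟨(α (shift w S).1).coeff (shift w S).2 / (β S.1).coeff S.2, div_ne_zero hα.1 hβ.1,
    fun U hU => lt_of_le_of_ne ?_ ?_⟩
  · have h := hU.1
    by_cases hU' : (α U.1).coeff U.2 = 0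
    · refine (hβ.monomial_smul hf w (div_ne_zero hα.1 hβ.1)).key_le fun h' => h ?_
      rw [Pi.sub_apply, coeff_sub, hU', h', sub_zero]
    · exact hα.key_le hU'
  · intro h
    obtain rfl := key_injective h
    refine hU.1 ?_
    rw [Pi.sub_apply, coeff_sub, coeff_monomial_smul_shift, div_mul_cancel₀ _ hβ.1, sub_self]

theorem hasSig_unitVec (i : Fin m) : HasSig mo f (unitVec i : FreeMod K n m) (i, 0) := by
  refine hasSig_of_key_le (by simp [unitVec]) fun U hU => ?_
  obtain ⟨j, a⟩ := U
  by_cases hj : j = i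
  · subst hj
    by_cases ha : 0 = a
    · rw [ha]
    · simp [unitVec, coeff_one, ha] at hU
  · simp [unitVec, hj] at hU

/-! ### Lead terms of images -/

theorem degree_proj_monomial_smul {α : FreeMod K n m} (h : proj f α ≠ 0) (w : Fin n →₀ ℕ)
    {c : K} (hc : c ≠ 0) :
    mo.degree (proj f (monomial w c • α)) = w + mo.degree (proj f α) := by
  classical
  rw [proj_smul, mo.degree_mul (by simpa using hc) h, mo.degree_monomial, if_neg hc]

theorem leadingCoeff_proj_monomial_smul (α : FreeMod K n m) (w : Fin n →₀ ℕ) (c : K) :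
    mo.leadingCoeff (proj f (monomial w c • α)) = c * mo.leadingCoeff (proj f α) := by
  rw [proj_smul, mo.leadingCoeff_mul, mo.leadingCoeff_monomial]

theorem degree_sub_of_lt {p q : MvPolynomial (Fin n) K} (h : mo.degree q ≺[mo] mo.degree p) :
    mo.degree (p - q) = mo.degree p := by
  have h' : mo.degree (-q) = mo.degree q := by
    simp [MonomialOrder.degree]
  rw [sub_eq_add_neg, mo.degree_add_of_lt (by rwa [h'])]

theorem degree_sub_of_gt {p q : MvPolynomial (Fin n) K} (h : mo.degree p ≺[mo] mo.degree q) :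
    mo.degree (p - q) = mo.degree q := by
  have h' : mo.degree (-q) = mo.degree q := by
    simp [MonomialOrder.degree]
  rw [sub_eq_add_neg, mo.degree_add_eq_right_of_lt (by rwa [h']), h']

theorem proj_sub_ne_zero {α β : FreeMod K n m}
    (h : mo.degree (proj f α) ≠ mo.degree (proj f β)) : proj f (α - β) ≠ 0 := by
  rw [proj_sub, sub_ne_zero]
  rintro h'
  exact h (by rw [h'])

/-! ### S-pairs -/

/-- The exponent of `cofactor`. -/
noncomputable def cofactorExp (mo : MonomialOrder (Fin n)) (f : Fin m → MvPolynomial (Fin n) K)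
    (α β : FreeMod K n m) : Fin n →₀ ℕ :=
  (mo.degree (proj f α) ⊔ mo.degree (proj f β)) - mo.degree (proj f α)

theorem cofactorExp_add (α β : FreeMod K n m) :
    cofactorExp mo f α β + mo.degree (proj f α) =
      mo.degree (proj f α) ⊔ mo.degree (proj f β) :=
  tsub_add_cancel_of_le le_sup_left

theorem cofactorExp_add' (α β : FreeMod K n m) :
    cofactorExp mo f β α + mo.degree (proj f β) =
      mo.degree (proj f α) ⊔ mo.degree (proj f β) := by
  rw [cofactorExp_add, sup_comm]

theorem hasSig_cofactor_smul (hf : ∀ i, f i ≠ 0) {α : FreeMod K n m} (β : FreeMod K n m)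
    (h0 : proj f α ≠ 0) {S : ModMon n m} (h : HasSig mo f α S) :
    HasSig mo f (cofactor mo f α β • α) (shift (cofactorExp mo f α β) S) :=
  h.monomial_smul hf _ (inv_ne_zero (mo.leadingCoeff_ne_zero_iff.2 h0))

theorem hasSig_spair {α β : FreeMod K n m} {S T : ModMon n m}
    (hα : HasSig mo f (cofactor mo f α β • α) S) (hβ : HasSig mo f (cofactor mo f β α • β) T)
    (h : key mo f T < key mo f S) : HasSig mo f ((Pair.spair α β).value mo f) S :=
  hα.sub_of_lt hβ h

/-- The pair set stores an S-pair in one order only, while arguments order the generators by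
signature; the two values differ by a sign. -/
theorem hasSig_spair_swap {α β : FreeMod K n m} {S : ModMon n m}
    (h : HasSig mo f ((Pair.spair α β).value mo f) S) :
    HasSig mo f ((Pair.spair β α).value mo f) S := by
  simpa [Pair.value] using h.neg

/-! ### Multiples of basis elements with given signature and lead monomial -/

/-- Some monomial multiple of an element of `G` has signature `V` and lead exponent `u`. -/
def IsMultiple (mo : MonomialOrder (Fin n)) (f : Fin m → MvPolynomial (Fin n) K)
    (G : Set (FreeMod K n m)) (u : Fin n →₀ ℕ) (V : ModMon n m) : Prop :=
  ∃ β ∈ G, ∃ S w, HasSig mo f β S ∧ w + mo.degree (proj f β) = u ∧ V = shift w S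

/-- A loop invariant of RB that suffices to prove that the computed basis is, below the
signatures that are still to be treated, a signature Gröbner basis. -/
structure BasisInvariant (mo : MonomialOrder (Fin n)) (f : Fin m → MvPolynomial (Fin n) K)
    (le : FreeMod K n m → FreeMod K n m → Prop) (s : State K n m) : Prop where
  finite : s.G.Finite
  proj_ne_zero : ∀ α ∈ s.G, proj f α ≠ 0
  proj_eq_zero : ∀ σ ∈ s.H, proj f σ = 0
  -- The multiples range over the whole basis, including elements added after `α`.
  irreducible : ∀ α ∈ s.G, ∀ T, HasSig mo f α T → ∀ V,
    IsMultiple mo f s.G (mo.degree (proj f α)) V → key mo f T ≤ key mo f V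
  unit_done : ∀ k, Pair.unit k ∈ s.P ∨ ∃ γ ∈ s.G ∪ s.H, IsRewriter mo f γ (k, 0)
  -- Each S-pair is pending (in either order), or has a rewritable generator, or has a substitute in
  -- its signature: a syzygy, or a basis element whose lead monomial is below the lcm because the
  -- lead terms of the generators cancel.
  pair_done : ∀ α ∈ s.G, ∀ β ∈ s.G, ∀ S T, HasSig mo f (cofactor mo f α β • α) S →
    HasSig mo f (cofactor mo f β α • β) T → key mo f T < key mo f S →
      Pair.spair α β ∈ s.P ∨ Pair.spair β α ∈ s.P ∨ Rewritable mo f le s.G s.H α S ∨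
      Rewritable mo f le s.G s.H β T ∨
      ∃ γ ∈ s.G ∪ s.H, HasSig mo f γ S ∧ (γ ∈ s.H ∨
        mo.degree (proj f γ) ≺[mo] mo.degree (proj f α) ⊔ mo.degree (proj f β))

/-- The signature `T` is smaller than all signatures in the pair set. -/
def Treated (mo : MonomialOrder (Fin n)) (f : Fin m → MvPolynomial (Fin n) K)
    (s : State K n m) (T : ModMon n m) : Prop :=
  ∀ p ∈ s.P, ∀ V, HasSig mo f (p.value mo f) V → key mo f T < key mo f V

/-- All elements of signature `T` with nonzero image are s-reducible. -/
def ReducibleAt (mo : MonomialOrder (Fin n)) (f : Fin m → MvPolynomial (Fin n) K)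
    (G : Set (FreeMod K n m)) (T : ModMon n m) : Prop :=
  ∀ α, HasSig mo f α T → proj f α ≠ 0 →
    ∃ V, key mo f V ≤ key mo f T ∧ IsMultiple mo f G (mo.degree (proj f α)) V

/-- Multiples in signature `T` of elements of `G` that are not rewritable are not regular
s-reducible at the lead term. -/
def IrreducibleAt (mo : MonomialOrder (Fin n)) (f : Fin m → MvPolynomial (Fin n) K)
    (le : FreeMod K n m → FreeMod K n m → Prop) (s : State K n m) (T : ModMon n m) : Prop :=
  ∀ γ ∈ s.G, ∀ S a, HasSig mo f γ S → T = shift a S → ¬ Rewritable mo f le s.G s.H γ T →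
    ∀ V, IsMultiple mo f s.G (a + mo.degree (proj f γ)) V → key mo f T ≤ key mo f V

/-! ### Maximal rewriters -/

theorem Rewritable.of_modDvd {G H : Set (FreeMod K n m)} {α : FreeMod K n m} {S T : ModMon n m}
    (h : Rewritable mo f le G H α S) (hST : ModDvd S T) : Rewritable mo f le G H α T := by
  obtain ⟨γ, hγ, hne, hle, U, hU, hUS⟩ := h
  exact ⟨γ, hγ, hne, hle, U, hU, hUS.trans hST⟩

theorem Rewritable.mono {G H G' H' : Set (FreeMod K n m)} {α : FreeMod K n m} {S : ModMon n m}
    (h : Rewritable mo f le G H α S) (hG : G ⊆ G') (hH : H ⊆ H') :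
    Rewritable mo f le G' H' α S := by
  obtain ⟨γ, hγ, h'⟩ := h
  exact ⟨γ, Set.union_subset_union hG hH hγ, h'⟩

theorem IsRewriteOrder.exists_max {G H : Set (FreeMod K n m)} (h : IsRewriteOrder le G H)
    {A : Set (FreeMod K n m)} (hA : A.Finite) (hAG : A ⊆ G) (hne : A.Nonempty) :
    ∃ γ ∈ A, ∀ α ∈ A, le α γ := by
  induction A, hA using Set.Finite.induction_on with
  | empty => exact absurd hne Set.not_nonempty_empty
  | @insert a A _ _ ih =>
    have ha : a ∈ G := hAG (Set.mem_insert _ _)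
    have hA : A ⊆ G := (Set.subset_insert _ _).trans hAG
    rcases A.eq_empty_or_nonempty with rfl | hne'
    · exact ⟨a, by simp, by simpa using h.refl a (Or.inl ha)⟩
    · obtain ⟨γ, hγ, hmax⟩ := ih hA hne'
      rcases h.total a ha γ (hA hγ) with hle | hle
      · refine ⟨γ, Or.inr hγ, ?_⟩
        rintro α (rfl | hα)
        · exact hle
        · exact hmax α hα
      · refine ⟨a, Or.inl rfl, ?_⟩
        rintro α (rfl | hα)
        · exact h.refl _ (Or.inl ha)
        · exact h.trans _ (Or.inl (hA hα)) _ (Or.inl (hA hγ)) _ (Or.inl ha) (hmax α hα) hle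

/-- If there is a rewriter in signature `T` but none among the syzygies, some basis element is a
rewriter whose multiple is not rewritable. -/
theorem exists_not_rewritable {s : State K n m} (hs : BasisInvariant mo f le s)
    (hle : IsRewriteOrder le s.G s.H) {T : ModMon n m}
    (hT : ∃ γ ∈ s.G ∪ s.H, IsRewriter mo f γ T) (hH : ∀ σ ∈ s.H, ¬ IsRewriter mo f σ T) :
    ∃ γ ∈ s.G, IsRewriter mo f γ T ∧ ¬ Rewritable mo f le s.G s.H γ T := by
  obtain ⟨γ, ⟨hγ, hγT⟩, hmax⟩ := hle.exists_max (A := {γ ∈ s.G | IsRewriter mo f γ T})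
    (hs.finite.subset (Set.sep_subset _ _)) (Set.sep_subset _ _) (by
      obtain ⟨γ, hγ | hγ, hγT⟩ := hT
      · exact ⟨γ, hγ, hγT⟩
      · exact absurd hγT (hH γ hγ))
  refine ⟨γ, hγ, hγT, ?_⟩
  rintro ⟨δ, hδ | hδ, hne, hγδ, hδT⟩
  · exact hne (hle.antisymm _ (Or.inl hδ) _ (Or.inl hγ) (hmax δ ⟨hδ, hδT⟩) hγδ)
  · exact hH δ hδ hδT

/-- Syzygies are preferred to basis elements, and differ from them because their images vanish. -/
theorem rewritable_of_syzygy {s : State K n m} (hs : BasisInvariant mo f le s)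
    (hle : IsAdmissibleOrder mo f le s.G s.H) {γ σ : FreeMod K n m} (hγ : γ ∈ s.G)
    (hσ : σ ∈ s.H) {T : ModMon n m} (hT : IsRewriter mo f σ T) :
    Rewritable mo f le s.G s.H γ T :=
  ⟨σ, Or.inr hσ, fun h => hs.proj_ne_zero γ hγ (h ▸ hs.proj_eq_zero σ hσ),
    hle.le_syzygy γ hγ σ hσ, hT⟩

/-- Cancelling the signature of `α` leaves an element that is reducible in a smaller signature. -/
theorem exists_isMultiple_of_cancel (hf : ∀ i, f i ≠ 0) {G : Set (FreeMod K n m)}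
    {T S : ModMon n m} (ih : ∀ U, key mo f U < key mo f T → ReducibleAt mo f G U)
    {α β : FreeMod K n m} {w : Fin n →₀ ℕ} (hα : HasSig mo f α T) (hβ : HasSig mo f β S)
    (hT : T = shift w S) :
    ∃ c : K, c ≠ 0 ∧ (proj f (α - monomial w c • β) ≠ 0 →
      ∃ V, key mo f V < key mo f T ∧
        IsMultiple mo f G (mo.degree (proj f (α - monomial w c • β))) V) := by
  obtain ⟨c, hc, h⟩ := hα.exists_cancel hf hβ hT
  refine ⟨c, hc, fun h0 => ?_⟩
  obtain ⟨U, hU⟩ := exists_hasSig mo f (α := α - monomial w c • β) (by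
    intro h'
    rw [h', proj_zero] at h0
    exact h0 rfl)
  obtain ⟨V, hV, hm⟩ := ih U (h U hU) _ hU h0
  exact ⟨V, hV.trans_lt (h U hU), hm⟩

/-- The possible outcomes of cancelling the signature of `α` with a multiple of `β`. -/
theorem isMultiple_trichotomy (hf : ∀ i, f i ≠ 0) {G : Set (FreeMod K n m)}
    {T S : ModMon n m} (ih : ∀ U, key mo f U < key mo f T → ReducibleAt mo f G U)
    {α β : FreeMod K n m} {w : Fin n →₀ ℕ} (hα : HasSig mo f α T) (hβ : HasSig mo f β S)
    (hT : T = shift w S) (hβ0 : proj f β ≠ 0) :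
    w + mo.degree (proj f β) = mo.degree (proj f α) ∨
      (∃ V, key mo f V < key mo f T ∧ IsMultiple mo f G (mo.degree (proj f α)) V) ∨
      ∃ V, key mo f V < key mo f T ∧ IsMultiple mo f G (w + mo.degree (proj f β)) V := by
  obtain ⟨c, hc, h⟩ := exists_isMultiple_of_cancel hf ih hα hβ hT
  have hd := degree_proj_monomial_smul (mo := mo) hβ0 w hc
  -- If the two lead monomials differ, the difference keeps the larger one, and its signature is
  -- below `T`, so the induction hypothesis applies to it.
  rcases lt_trichotomy (mo.toSyn (w + mo.degree (proj f β)))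
    (mo.toSyn (mo.degree (proj f α))) with hlt | heq | hgt
  · right; left
    have h' := h (proj_sub_ne_zero (mo := mo) fun h' => by
      rw [h', hd] at hlt; exact hlt.false)
    rwa [proj_sub, degree_sub_of_lt (by rwa [hd])] at h'
  · exact Or.inl (mo.toSyn.injective heq)
  · right; right
    have h' := h (proj_sub_ne_zero (mo := mo) fun h' => by
      rw [h', hd] at hgt; exact hgt.false)
    rwa [proj_sub, degree_sub_of_gt (by rwa [hd]), hd] at h'

/-- Subtracting a multiple of a syzygy lowers the signature and leaves the image unchanged. -/
theorem isMultiple_of_syzygy (hf : ∀ i, f i ≠ 0) {G : Set (FreeMod K n m)}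
    {T : ModMon n m} (ih : ∀ U, key mo f U < key mo f T → ReducibleAt mo f G U)
    {α σ : FreeMod K n m} (hα : HasSig mo f α T) (hσ : IsRewriter mo f σ T)
    (hα0 : proj f α ≠ 0) (hσ0 : proj f σ = 0) :
    ∃ V, key mo f V < key mo f T ∧ IsMultiple mo f G (mo.degree (proj f α)) V := by
  obtain ⟨S, hS, hST⟩ := hσ
  obtain ⟨w, hT⟩ := modDvd_iff_exists_shift.1 hST
  obtain ⟨c, -, h⟩ := exists_isMultiple_of_cancel hf ih hα hS hT
  have hp : proj f (α - monomial w c • σ) = proj f α := by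
    rw [proj_sub, proj_smul, hσ0, mul_zero, sub_zero]
  rw [hp] at h
  exact h hα0

/-! ### Correctness of RB -/

/-- A regular reducer of a non-rewritable multiple of γ can be replaced by a non-rewritable multiple
of some β with the same lead monomial. The two multiples are then a common multiple of the
generators of the S-pair of γ and β, and every way in which this pair can have been dealt with is
contradictory. -/
theorem irreducibleAt_of_treated (hf : ∀ i, f i ≠ 0) {s : State K n m}
    (hs : BasisInvariant mo f le s) (hle : IsAdmissibleOrder mo f le s.G s.H) {T : ModMon n m}
    (hT : Treated mo f s T) (ihR : ∀ U, key mo f U < key mo f T → ReducibleAt mo f s.G U)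
    (ihI : ∀ U, key mo f U < key mo f T → IrreducibleAt mo f le s U) :
    IrreducibleAt mo f le s T := by
  intro γ hγ S a hS hTS hrew V₀ hV₀
  by_contra! hlt₀
  set u := a + mo.degree (proj f γ) with hu
  -- Among the multiples with lead exponent `u`, one of minimal signature is chosen; the minimality
  -- rules out a syzygy dividing `V` and any further reduction at `u`.
  obtain ⟨V, hV, hmin⟩ := (InvImage.wf (key mo f) wellFounded_lt).has_min
    {V | IsMultiple mo f s.G u V} ⟨V₀, hV₀⟩
  replace hmin : ∀ U, key mo f U < key mo f V → ¬ IsMultiple mo f s.G u U :=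
    fun U hU hm => hmin U hm hU
  have hVT : key mo f V < key mo f T :=
    (not_lt.1 fun h => hmin _ h hV₀).trans_lt hlt₀
  have ihV : ∀ U, key mo f U < key mo f V → ReducibleAt mo f s.G U :=
    fun U hU => ihR U (hU.trans hVT)
  obtain ⟨β₀, hβ₀, S₀, w₀, hS₀, hu₀, hV₀⟩ := hV
  have hsig₀ : HasSig mo f (monomial w₀ (1 : K) • β₀) V := by
    rw [hV₀]; exact hS₀.monomial_smul hf w₀ one_ne_zero
  have hdeg₀ : mo.degree (proj f (monomial w₀ (1 : K) • β₀)) = u := by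
    rw [degree_proj_monomial_smul (hs.proj_ne_zero _ hβ₀) _ one_ne_zero, hu₀]
  have hne₀ : proj f (monomial w₀ (1 : K) • β₀) ≠ 0 := by
    rw [proj_smul]
    exact mul_ne_zero (by simp) (hs.proj_ne_zero _ hβ₀)
  obtain ⟨β, hβ, ⟨S', hS', hdvd⟩, hβrew⟩ := exists_not_rewritable hs hle.toIsRewriteOrder
    ⟨β₀, Or.inl hβ₀, S₀, hS₀, hV₀ ▸ modDvd_shift _ _⟩ (T := V) (by
      intro σ hσ hr
      obtain ⟨U, hU, hm⟩ := isMultiple_of_syzygy hf ihV hsig₀ hr hne₀ (hs.proj_eq_zero σ hσ)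
      rw [hdeg₀] at hm
      exact hmin U hU hm)
  obtain ⟨b, hb⟩ := modDvd_iff_exists_shift.1 hdvd
  -- The multiple of the maximal rewriter also has lead exponent `u`: a smaller lead would
  -- contradict the minimality of `V`, a larger one the irreducibility in signature `V`.
  have hbu : b + mo.degree (proj f β) = u := by
    rcases isMultiple_trichotomy hf ihV hsig₀ hS' hb (hs.proj_ne_zero _ hβ) with
      h | ⟨U, hU, hm⟩ | ⟨U, hU, hm⟩
    · rw [h, hdeg₀]
    · rw [hdeg₀] at hm
      exact absurd hm (hmin U hU)
    · exact absurd (ihI V hVT β hβ S' b hS' hb hβrew U hm) hU.not_ge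
  have hL : mo.degree (proj f γ) ⊔ mo.degree (proj f β) ≤ u :=
    sup_le (hu ▸ le_add_self) (hbu ▸ le_add_self)
  set a' := cofactorExp mo f γ β with ha'
  set b' := cofactorExp mo f β γ with hb'
  have haL : a' + mo.degree (proj f γ) = _ := cofactorExp_add γ β
  have hbL : b' + mo.degree (proj f β) = _ := cofactorExp_add' γ β
  set L := mo.degree (proj f γ) ⊔ mo.degree (proj f β) with hLdef
  obtain ⟨r, hr⟩ := exists_add_of_le hL
  have har : a = r + a' := by
    apply add_right_cancel (b := mo.degree (proj f γ))
    rw [← hu, add_assoc, haL, hr, add_comm]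
  have hbr : b = r + b' := by
    apply add_right_cancel (b := mo.degree (proj f β))
    rw [hbu, add_assoc, hbL, hr, add_comm]
  have hX := hasSig_cofactor_smul hf β (hs.proj_ne_zero _ hγ) hS
  have hY := hasSig_cofactor_smul hf γ (hs.proj_ne_zero _ hβ) hS'
  rw [← ha'] at hX
  rw [← hb'] at hY
  have hTX : T = shift r (shift a' S) := by rw [hTS, har, shift_add]
  have hVY : V = shift r (shift b' S') := by rw [hb, hbr, shift_add]
  have hYX : key mo f (shift b' S') < key mo f (shift a' S) := by
    rwa [hTX, hVY, key_shift_lt hf] at hVT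
  have hXT : key mo f (shift a' S) ≤ key mo f T := by
    rw [hTX]; exact key_le_shift hf _ _
  have hsp := hasSig_spair hX hY hYX
  rcases hs.pair_done γ hγ β hβ _ _ hX hY hYX with h | h | h | h | ⟨δ, hδ, hδX, hδ'⟩
  · exact (hT _ h _ hsp).not_ge hXT
  · exact (hT _ h _ (hasSig_spair_swap hsp)).not_ge hXT
  · exact hrew (h.of_modDvd (hTX ▸ modDvd_shift _ _))
  · exact hβrew (h.of_modDvd (hVY ▸ modDvd_shift _ _))
  · have hδT : IsRewriter mo f δ T := ⟨_, hδX, hTX ▸ modDvd_shift _ _⟩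
    by_cases hδH : δ ∈ s.H
    · exact hrew (rewritable_of_syzygy hs hle hγ hδH hδT)
    · have hδG : δ ∈ s.G := hδ.resolve_right hδH
      replace hδ' := hδ'.resolve_left hδH
      -- If the cofactor of `γ` were trivial, the multiple of `β` would reduce `γ` itself regularly.
      -- Proper divisibility is what `le_of_dvd` requires.
      have hSX : S ≠ shift a' S := by
        intro h
        have h0 : a' = 0 := by
          have h2 := congrArg Prod.snd h
          simpa [shift] using h2
        have hle' := hs.irreducible γ hγ S hS (shift b' S') ⟨β, hβ, S', b', hS', by
          rw [hbL, ← haL, h0, zero_add], rfl⟩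
        rw [h] at hle'
        exact hle'.not_gt hYX
      refine hrew ⟨δ, Or.inl hδG, ?_, ?_, hδT⟩
      · rintro rfl
        exact hSX (hS.unique hδX)
      · refine hle.le_of_dvd γ hγ δ hδG S _ hS hδX (modDvd_shift _ _) hSX ?_
        -- With this identity the ratio condition reduces to the lead monomial of `δ` being at most
        -- the lcm `L`.
        have h2 : (shift a' S).2 + mo.degree (proj f γ) = S.2 + L := by
          rw [← haL]
          simp only [shift]
          abel
        rw [h2, map_add, map_add]
        gcongr

/-- Comparison with the maximal rewriter in signature `T`: either the lead monomials agree, or the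
lead of `α` is reducible in a smaller signature, or the rewriter's multiple is, which irreducibility
forbids. -/
theorem reducibleAt_of_treated (hf : ∀ i, f i ≠ 0) {s : State K n m}
    (hs : BasisInvariant mo f le s) (hle : IsAdmissibleOrder mo f le s.G s.H) {T : ModMon n m}
    (hT : Treated mo f s T) (ihR : ∀ U, key mo f U < key mo f T → ReducibleAt mo f s.G U)
    (hI : IrreducibleAt mo f le s T) : ReducibleAt mo f s.G T := by
  intro α hα hα0
  have hrew : ∃ γ ∈ s.G ∪ s.H, IsRewriter mo f γ T := by
    have hdvd : T = shift T.2 (T.1, 0) := by simp [shift]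
    rcases hs.unit_done T.1 with h | ⟨γ, hγ, S, hS, hST⟩
    -- A pending unit vector in the position of `T` would have a signature dividing `T`, although
    -- all pending signatures exceed `T`.
    · refine absurd (hT _ h _ (hasSig_unitVec T.1)) (not_lt.2 ?_)
      conv_rhs => rw [hdvd]
      exact key_le_shift hf _ _
    · exact ⟨γ, hγ, S, hS, hST.trans (by rw [hdvd]; exact modDvd_shift _ _)⟩
  by_cases hH : ∃ σ ∈ s.H, IsRewriter mo f σ T
  · obtain ⟨σ, hσ, hr⟩ := hH
    obtain ⟨V, hV, hm⟩ := isMultiple_of_syzygy hf ihR hα hr hα0 (hs.proj_eq_zero σ hσ)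
    exact ⟨V, hV.le, hm⟩
  · push Not at hH
    obtain ⟨γ, hγ, ⟨S, hS, hST⟩, hγrew⟩ := exists_not_rewritable hs hle.toIsRewriteOrder hrew hH
    obtain ⟨w, hw⟩ := modDvd_iff_exists_shift.1 hST
    rcases isMultiple_trichotomy hf ihR hα hS hw (hs.proj_ne_zero _ hγ) with
      h | ⟨U, hU, hm⟩ | ⟨U, hU, hm⟩
    · exact ⟨T, le_rfl, γ, hγ, S, w, hS, h, hw⟩
    · exact ⟨U, hU.le, hm⟩
    · exact absurd (hI γ hγ S w hS hw hγrew U hm) hU.not_ge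

/-- RB computes a signature Gröbner basis up to the signatures still to be treated. -/
theorem reducibleAt (hf : ∀ i, f i ≠ 0) {s : State K n m} (hs : BasisInvariant mo f le s)
    (hle : IsAdmissibleOrder mo f le s.G s.H) (T : ModMon n m) (hT : Treated mo f s T) :
    ReducibleAt mo f s.G T := by
  -- The claims need a joint induction: irreducibility at `T` uses both below `T`, and reducibility
  -- at `T` uses irreducibility at `T`.
  suffices h : ReducibleAt mo f s.G T ∧ IrreducibleAt mo f le s T from h.1
  induction T using (InvImage.wf (key mo f) wellFounded_lt).induction with
  | h T ih =>
    have ih' : ∀ U, key mo f U < key mo f T →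
        ReducibleAt mo f s.G U ∧ IrreducibleAt mo f le s U :=
      fun U hU => ih U hU fun p hp V hV => hU.trans (hT p hp V hV)
    have hI := irreducibleAt_of_treated hf hs hle hT (fun U hU => (ih' U hU).1)
      fun U hU => (ih' U hU).2
    exact ⟨reducibleAt_of_treated hf hs hle hT (fun U hU => (ih' U hU).1) hI, hI⟩

/-! ### Homogeneous elements -/

/-- All module monomials that occur in `α` have degree `D`. -/
def IsHom (f : Fin m → MvPolynomial (Fin n) K) (α : FreeMod K n m) (D : ℕ) : Prop :=
  ∀ U : ModMon n m, (α U.1).coeff U.2 ≠ 0 → sigDegree f U = D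

theorem IsHom.sub {α β : FreeMod K n m} {D : ℕ} (hα : IsHom f α D) (hβ : IsHom f β D) :
    IsHom f (α - β) D := by
  intro U hU
  by_cases h : (α U.1).coeff U.2 = 0
  · exact hβ U fun h' => hU (by simp [h, h'])
  · exact hα U h

theorem IsHom.monomial_smul (hf : ∀ i, f i ≠ 0) {α : FreeMod K n m} {D : ℕ} (h : IsHom f α D)
    (w : Fin n →₀ ℕ) (c : K) : IsHom f (monomial w c • α) (w.degree + D) := by
  intro U hU
  obtain ⟨V, rfl, hV⟩ := exists_shift_of_coeff_ne_zero hU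
  rw [sigDegree_shift hf, h V hV]

theorem isHom_unitVec (i : Fin m) :
    IsHom f (unitVec i : FreeMod K n m) (sigDegree f (i, (0 : Fin n →₀ ℕ))) := by
  rintro ⟨j, a⟩ hU
  by_cases hj : j = i
  · subst hj
    by_cases ha : 0 = a
    · rw [ha]
    · simp [unitVec, coeff_one, ha] at hU
  · simp [unitVec, hj] at hU

/-- In a fixed position the degree of f_i is a constant shift, so equal module degrees force equal
polynomial degrees. -/
theorem IsHom.isHomogeneous_apply (hf : ∀ i, f i ≠ 0) {α : FreeMod K n m} {D : ℕ}
    (h : IsHom f α D) {i : Fin m} {a : Fin n →₀ ℕ} (ha : (α i).coeff a ≠ 0) :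
    (α i).IsHomogeneous a.degree := by
  intro b hb
  have h1 := h (i, a) ha
  have h2 := h (i, b) hb
  rw [sigDegree_eq hf] at h1 h2
  have h3 : Finsupp.weight (1 : Fin n → ℕ) b = b.degree :=
    (DFunLike.congr_fun (Finsupp.degree_eq_weight_one (R := ℕ)) b).symm
  rw [h3]
  dsimp only at h1 h2
  omega

theorem IsHom.isHomogeneous_mul (hf : ∀ i, f i ≠ 0) (hhom : ∀ i, ∃ d, (f i).IsHomogeneous d)
    {α : FreeMod K n m} {D : ℕ} (h : IsHom f α D) (i : Fin m) :
    (α i * f i).IsHomogeneous D := by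
  by_cases h0 : α i = 0
  · rw [h0, zero_mul]
    exact isHomogeneous_zero _ _ _
  obtain ⟨d, hd⟩ := hhom i
  obtain ⟨a, ha⟩ := MvPolynomial.ne_zero_iff.1 h0
  have hD := h (i, a) ha
  rw [sigDegree_eq hf, hd.totalDegree (hf i)] at hD
  rw [← hD]
  exact (h.isHomogeneous_apply hf ha).mul hd

theorem IsHom.isHomogeneous_proj (hf : ∀ i, f i ≠ 0) (hhom : ∀ i, ∃ d, (f i).IsHomogeneous d)
    {α : FreeMod K n m} {D : ℕ} (h : IsHom f α D) : (proj f α).IsHomogeneous D :=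
  IsHomogeneous.sum _ _ _ fun i _ => h.isHomogeneous_mul hf hhom i

theorem IsHom.degree_eq_of_mem_support (hf : ∀ i, f i ≠ 0)
    (hhom : ∀ i, ∃ d, (f i).IsHomogeneous d) {α : FreeMod K n m} {D : ℕ} (h : IsHom f α D)
    {v : Fin n →₀ ℕ} (hv : v ∈ (proj f α).support) : v.degree = D := by
  by_contra hne
  exact mem_support_iff.1 hv ((h.isHomogeneous_proj hf hhom).coeff_eq_zero hne)

/-- On a homogeneous element all degrees tie, so the order acts as position over term. -/
theorem IsHom.index_le {α : FreeMod K n m} {D : ℕ} (h : IsHom f α D) {T U : ModMon n m}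
    (hT : HasSig mo f α T) (hU : (α U.1).coeff U.2 ≠ 0) : U.1 ≤ T.1 := by
  by_cases hUT : U = T
  · rw [hUT]
  · rcases hT.2 U hU hUT with h' | ⟨-, h' | h'⟩
    · rw [h U hU, h T hT.1] at h'
      exact absurd h' (lt_irrefl _)
    · exact h'.le
    · exact h'.1.le

/-! ### Regular s-reduction -/

/-- All monomials of `p` are smaller than `u`. -/
def IsBelow (mo : MonomialOrder (Fin n)) (p : MvPolynomial (Fin n) K) (u : Fin n →₀ ℕ) : Prop :=
  ∀ v ∈ p.support, v ≺[mo] u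

theorem IsBelow.sub {p q : MvPolynomial (Fin n) K} {u : Fin n →₀ ℕ} (hp : IsBelow mo p u)
    (hq : IsBelow mo q u) : IsBelow mo (p - q) u := by
  classical
  intro v hv
  rcases Finset.mem_union.1 (support_sub _ p q hv) with h | h
  · exact hp v h
  · exact hq v h

theorem RegularStep.hasSig {G : Set (FreeMod K n m)} {α α' : FreeMod K n m} {T : ModMon n m}
    (h : RegularStep mo f G α α') (hα : HasSig mo f α T) : HasSig mo f α' T := by
  obtain ⟨β, -, w, c, -, -, ⟨S, T', hS, hT', hlt⟩, rfl⟩ := h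
  obtain rfl := hα.unique hT'
  exact hα.sub_of_lt hS (dPotLT_iff.1 hlt)

theorem RegularStep.exists_mem_support {G : Set (FreeMod K n m)} (hG : ∀ α ∈ G, proj f α ≠ 0)
    {α α' : FreeMod K n m} (h : RegularStep mo f G α α') :
    ∃ β ∈ G, ∃ (w : Fin n →₀ ℕ) (c : K), c ≠ 0 ∧ α' = α - monomial w c • β ∧
      mo.degree (proj f (monomial w c • β)) ∈ (proj f α).support ∧
      proj f (monomial w c • β) ≠ 0 := by
  obtain ⟨β, hβ, w, c, hc, ⟨v, hv, hlt⟩, -, rfl⟩ := h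
  refine ⟨β, hβ, w, c, hc, rfl, ?_, ?_⟩
  · rw [← mo.degree_leadingTerm, hlt]
    classical
    rwa [mo.degree_monomial, if_neg (mem_support_iff.1 hv)]
  · rw [proj_smul]
    exact mul_ne_zero (by simpa using hc) (hG β hβ)

/-- A step may act on any term, not only the leading one; the subtracted image has that term as its
lead, so nothing above it is introduced. -/
theorem RegularStep.isBelow {G : Set (FreeMod K n m)} (hG : ∀ α ∈ G, proj f α ≠ 0)
    {α α' : FreeMod K n m} (h : RegularStep mo f G α α') {u : Fin n →₀ ℕ}
    (hα : IsBelow mo (proj f α) u) : IsBelow mo (proj f α') u := by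
  obtain ⟨β, -, w, c, -, rfl, hv, -⟩ := h.exists_mem_support hG
  rw [proj_sub]
  exact hα.sub fun v' hv' => (mo.le_degree hv').trans_lt (hα _ hv)

/-- The lead monomial of the subtracted image occurs in the image of `α`, which forces the two
degrees to agree. -/
theorem RegularStep.isHom (hf : ∀ i, f i ≠ 0) (hhom : ∀ i, ∃ d, (f i).IsHomogeneous d)
    {G : Set (FreeMod K n m)} (hG : ∀ α ∈ G, proj f α ≠ 0) (hG' : ∀ α ∈ G, ∃ D, IsHom f α D)
    {α α' : FreeMod K n m} (h : RegularStep mo f G α α') {D : ℕ} (hα : IsHom f α D) :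
    IsHom f α' D := by
  obtain ⟨β, hβ, w, c, -, rfl, hv, h0⟩ := h.exists_mem_support hG
  obtain ⟨D', hD'⟩ := hG' β hβ
  have hD := hD'.monomial_smul hf w c
  have hdeg := hD.degree_eq_of_mem_support hf hhom (mo.degree_mem_support h0)
  rw [hα.degree_eq_of_mem_support hf hhom hv] at hdeg
  rw [← hdeg] at hD
  exact hα.sub hD

/-- A multiple with the same lead monomial and a smaller signature, scaled by the quotient of the
leading coefficients, would permit another regular step. -/
theorem RegularResult.key_le {G : Set (FreeMod K n m)} (hf : ∀ i, f i ≠ 0)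
    (hG : ∀ α ∈ G, proj f α ≠ 0) {α γ : FreeMod K n m} (h : RegularResult mo f G α γ)
    {T : ModMon n m} (hT : HasSig mo f γ T) (h0 : proj f γ ≠ 0) {V : ModMon n m}
    (hV : IsMultiple mo f G (mo.degree (proj f γ)) V) : key mo f T ≤ key mo f V := by
  obtain ⟨β, hβ, S, w, hS, hw, rfl⟩ := hV
  by_contra! hlt
  have hβ0 := mo.leadingCoeff_ne_zero_iff.2 (hG β hβ)
  have hc : mo.leadingCoeff (proj f γ) / mo.leadingCoeff (proj f β) ≠ 0 :=
    div_ne_zero (mo.leadingCoeff_ne_zero_iff.2 h0) hβ0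
  refine h.2 ⟨_, β, hβ, w, _, hc, ⟨mo.degree (proj f γ), mo.degree_mem_support h0, ?_⟩,
    ⟨_, T, hS.monomial_smul hf w hc, hT, dPotLT_iff.2 hlt⟩, rfl⟩
  rw [MonomialOrder.leadingTerm, leadingCoeff_proj_monomial_smul,
    degree_proj_monomial_smul (hG β hβ) w hc, hw, div_mul_cancel₀ _ hβ0]
  rfl

/-! ### S-pairs of homogeneous elements -/

theorem degree_proj_cofactor_smul {α : FreeMod K n m} (β : FreeMod K n m)
    (h0 : proj f α ≠ 0) : mo.degree (proj f (cofactor mo f α β • α)) =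
      mo.degree (proj f α) ⊔ mo.degree (proj f β) := by
  rw [cofactor, degree_proj_monomial_smul h0 _ (inv_ne_zero (mo.leadingCoeff_ne_zero_iff.2 h0)),
    tsub_add_cancel_of_le le_sup_left]

theorem coeff_proj_cofactor_smul {α : FreeMod K n m} (β : FreeMod K n m)
    (h0 : proj f α ≠ 0) : (proj f (cofactor mo f α β • α)).coeff
      (mo.degree (proj f α) ⊔ mo.degree (proj f β)) = 1 := by
  rw [← degree_proj_cofactor_smul β h0]
  show mo.leadingCoeff _ = 1
  rw [cofactor, leadingCoeff_proj_monomial_smul,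
    inv_mul_cancel₀ (mo.leadingCoeff_ne_zero_iff.2 h0)]

theorem isBelow_spair {α β : FreeMod K n m} (hα : proj f α ≠ 0) (hβ : proj f β ≠ 0) :
    IsBelow mo (proj f ((Pair.spair α β).value mo f))
      (mo.degree (proj f α) ⊔ mo.degree (proj f β)) := by
  classical
  intro v hv
  have h1 := degree_proj_cofactor_smul (mo := mo) β hα
  have h2 := degree_proj_cofactor_smul (mo := mo) α hβ
  rw [sup_comm] at h2
  rw [Pair.value, proj_sub] at hv
  refine lt_of_le_of_ne ?_ ?_
  · rcases Finset.mem_union.1 (support_sub _ _ _ hv) with h | h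
    · rw [← h1]; exact mo.le_degree h
    · rw [← h2]; exact mo.le_degree h
  · intro he
    obtain rfl := mo.toSyn.injective he
    refine mem_support_iff.1 hv ?_
    rw [coeff_sub, coeff_proj_cofactor_smul β hα, sup_comm, coeff_proj_cofactor_smul α hβ,
      sub_self]

/-- The images of both generators have the lcm as lead monomial, so both generators have the degree
of the lcm. -/
theorem exists_isHom_spair (hf : ∀ i, f i ≠ 0) (hhom : ∀ i, ∃ d, (f i).IsHomogeneous d)
    {α β : FreeMod K n m} (hα : proj f α ≠ 0) (hβ : proj f β ≠ 0)
    (hα' : ∃ D, IsHom f α D) (hβ' : ∃ D, IsHom f β D) :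
    ∃ D, IsHom f ((Pair.spair α β).value mo f) D := by
  have key : ∀ {α : FreeMod K n m} (β : FreeMod K n m), proj f α ≠ 0 → (∃ D, IsHom f α D) →
      IsHom f (cofactor mo f α β • α)
        (mo.degree (proj f α) ⊔ mo.degree (proj f β)).degree := by
    rintro α β hα ⟨D, hD⟩
    have h : IsHom f (cofactor mo f α β • α) _ := hD.monomial_smul hf _ _
    have h' := h.degree_eq_of_mem_support hf hhom (v := mo.degree _) (mo.degree_mem_support (by
      rw [proj_smul, cofactor]
      exact mul_ne_zero (by simpa using hα) hα))
    rw [degree_proj_cofactor_smul β hα] at h'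
    rwa [h']
  refine ⟨_, (key β hα hα').sub ?_⟩
  rw [sup_comm]
  exact key α hβ hβ'

theorem exists_hasSig_cofactor (hf : ∀ i, f i ≠ 0) {α β : FreeMod K n m}
    (h : IsRegularPair mo f α β) : ∃ S T,
      HasSig mo f α S ∧ HasSig mo f β T ∧
      HasSig mo f (cofactor mo f α β • α) (shift (cofactorExp mo f α β) S) ∧
      HasSig mo f (cofactor mo f β α • β) (shift (cofactorExp mo f β α) T) ∧
      shift (cofactorExp mo f α β) S ≠ shift (cofactorExp mo f β α) T := by
  obtain ⟨S, T, hS, hT, hne⟩ := h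
  obtain ⟨S', hS', rfl⟩ := hS.exists_of_monomial_smul hf
  obtain ⟨T', hT', rfl⟩ := hT.exists_of_monomial_smul hf
  exact ⟨S', T', hS', hT', hS, hT, hne⟩

/-! ### The loop invariant -/

/-- The loop invariant of RB. -/
structure Invariant (mo : MonomialOrder (Fin n)) (f : Fin m → MvPolynomial (Fin n) K)
    (le : FreeMod K n m → FreeMod K n m → Prop) (s : State K n m) : Prop
    extends BasisInvariant mo f le s where
  isHom : ∀ α ∈ s.G, ∃ D, IsHom f α D
  pair_mem : ∀ p ∈ s.P, (∃ k, p = Pair.unit k) ∨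
    ∃ α ∈ s.G, ∃ β ∈ s.G, IsRegularPair mo f α β ∧ p = Pair.spair α β
  le_pair : ∀ p ∈ s.P, ∀ T, HasSig mo f (p.value mo f) T → ∀ α ∈ s.G, ∀ S, HasSig mo f α S →
    key mo f S ≤ key mo f T
  deg_le : ∀ p ∈ s.P, ∀ T, HasSig mo f (p.value mo f) T → s.deg ≤ sigDegree f T
  -- The degree bound is strict: elements found during the current degree step get their Koszul
  -- syzygies only when the next one starts.
  koszul : ∀ α ∈ s.G, ∀ S, HasSig mo f α S → sigDegree f S < s.deg → ∀ k, S.1 < k →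
    proj f α • unitVec k - f k • α ∈ s.H

theorem proj_koszul (α : FreeMod K n m) (k : Fin m) :
    proj f (proj f α • unitVec k - f k • α) = 0 := by
  rw [proj_sub, proj_smul, proj_smul, proj_unitVec, mul_comm, sub_self]

theorem invariant_initState : Invariant mo f le (initState f) where
  finite := Set.finite_empty
  proj_ne_zero _ h := absurd h (Set.notMem_empty _)
  proj_eq_zero := by
    rintro σ ⟨i, j, -, rfl⟩
    rw [proj_sub, proj_smul, proj_smul, proj_unitVec, proj_unitVec, mul_comm, sub_self]
  irreducible _ h := absurd h (Set.notMem_empty _)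
  unit_done k := Or.inl ⟨k, rfl⟩
  pair_done _ h := absurd h (Set.notMem_empty _)
  isHom _ h := absurd h (Set.notMem_empty _)
  pair_mem := by
    rintro p ⟨k, rfl⟩
    exact Or.inl ⟨k, rfl⟩
  le_pair _ _ _ _ _ h := absurd h (Set.notMem_empty _)
  deg_le _ _ _ _ := Nat.zero_le _
  koszul _ h := absurd h (Set.notMem_empty _)

/-! ### Preservation of the invariant by the steps of RB -/

theorem Invariant.newDegree {s : State K n m} (hs : Invariant mo f le s) {p : Pair K n m}
    {T : ModMon n m} (hp : IsNext mo f s p T) :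
    Invariant mo f le { s with H := s.H ∪ basisKoszul mo f s.G, deg := sigDegree f T } where
  finite := hs.finite
  proj_ne_zero := hs.proj_ne_zero
  proj_eq_zero := by
    rintro σ (hσ | ⟨α, -, S, -, k, -, rfl⟩)
    · exact hs.proj_eq_zero σ hσ
    · exact proj_koszul α k
  irreducible := hs.irreducible
  unit_done k := (hs.unit_done k).imp_right fun ⟨γ, hγ, h⟩ =>
    ⟨γ, hγ.imp_right Or.inl, h⟩
  pair_done α hα β hβ S U hS hU h := by
    rcases hs.pair_done α hα β hβ S U hS hU h with h | h | h | h | ⟨γ, hγ, h, h'⟩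
    · exact Or.inl h
    · exact Or.inr (Or.inl h)
    · exact Or.inr (Or.inr (Or.inl (h.mono subset_rfl Set.subset_union_left)))
    · exact Or.inr (Or.inr (Or.inr (Or.inl (h.mono subset_rfl Set.subset_union_left))))
    · exact Or.inr (Or.inr (Or.inr (Or.inr
        ⟨γ, hγ.imp_right Or.inl, h, h'.imp_left Or.inl⟩)))
  isHom := hs.isHom
  pair_mem := hs.pair_mem
  le_pair := hs.le_pair
  deg_le q hq U hU := by
    refine sigDegree_le_of_key_le (mo := mo) (not_lt.1 ?_)
    rw [← dPotLT_iff]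
    exact hp.2.2 q hq U hU
  koszul α hα S hS _ k hk := Or.inr ⟨α, hα, S, hS, k, hk, rfl⟩

theorem Invariant.discard {s : State K n m} (hs : Invariant mo f le s) {p : Pair K n m}
    (hr : p.IsRewritable mo f le s.G s.H) :
    Invariant mo f le { s with P := s.P \ {p} } where
  finite := hs.finite
  proj_ne_zero := hs.proj_ne_zero
  proj_eq_zero := hs.proj_eq_zero
  irreducible := hs.irreducible
  unit_done k := by
    by_cases hk : p = Pair.unit k
    · subst hk
      exact Or.inr hr
    · exact (hs.unit_done k).imp_left fun h => ⟨h, fun h' => hk h'.symm⟩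
  pair_done α hα β hβ S U hS hU h := by
    by_cases h1 : p = Pair.spair α β
    · subst h1
      rcases hr with ⟨S', hS', hr⟩ | ⟨S', hS', hr⟩
      · rw [hS'.unique hS] at hr
        exact Or.inr (Or.inr (Or.inl hr))
      · rw [hS'.unique hU] at hr
        exact Or.inr (Or.inr (Or.inr (Or.inl hr)))
    by_cases h2 : p = Pair.spair β α
    · subst h2
      rcases hr with ⟨S', hS', hr⟩ | ⟨S', hS', hr⟩
      · rw [hS'.unique hU] at hr
        exact Or.inr (Or.inr (Or.inr (Or.inl hr)))
      · rw [hS'.unique hS] at hr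
        exact Or.inr (Or.inr (Or.inl hr))
    exact (hs.pair_done α hα β hβ S U hS hU h).imp (fun h => ⟨h, fun h' => h1 h'.symm⟩)
      (Or.imp_left fun h => ⟨h, fun h' => h2 h'.symm⟩)
  isHom := hs.isHom
  pair_mem q hq := hs.pair_mem q hq.1
  le_pair q hq := hs.le_pair q hq.1
  deg_le q hq := hs.deg_le q hq.1
  koszul := hs.koszul

/-- What is known about the result `γ` of regular s-reducing the next element of the pair set. -/
theorem Invariant.exists_sig (hf : ∀ i, f i ≠ 0) (hhom : ∀ i, ∃ d, (f i).IsHomogeneous d)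
    {s : State K n m} (hs : Invariant mo f le s) {p : Pair K n m} {γ : FreeMod K n m}
    (h : Reduces mo f le s p γ) :
    ∃ T, IsNext mo f s p T ∧ sigDegree f T = s.deg ∧ HasSig mo f γ T ∧ (∃ D, IsHom f γ D) ∧
      ∀ α β, p = Pair.spair α β →
        IsBelow mo (proj f γ) (mo.degree (proj f α) ⊔ mo.degree (proj f β)) := by
  obtain ⟨⟨T, hT, hdeg⟩, -, hγ, -⟩ := h
  -- Signature, homogeneity and the bound by the lcm are all carried along the reduction by this one
  -- induction.
  have hinv : ∀ Q : FreeMod K n m → Prop, Q (p.value mo f) →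
      (∀ α β, RegularStep mo f s.G α β → Q α → Q β) → Q γ := by
    intro Q h0 hstep
    induction hγ with
    | refl => exact h0
    | tail _ h ih => exact hstep _ _ h ih
  refine ⟨T, hT, hdeg.antisymm (hs.deg_le p hT.1 T hT.2.1),
    hinv _ hT.2.1 fun α β h => h.hasSig, ?_, ?_⟩
  · have hp : ∃ D, IsHom f (p.value mo f) D := by
      rcases hs.pair_mem p hT.1 with ⟨k, rfl⟩ | ⟨α, hα, β, hβ, -, rfl⟩
      · exact ⟨_, isHom_unitVec k⟩
      · exact exists_isHom_spair hf hhom (hs.proj_ne_zero α hα) (hs.proj_ne_zero β hβ)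
          (hs.isHom α hα) (hs.isHom β hβ)
    obtain ⟨D, hD⟩ := hp
    exact ⟨D, hinv (IsHom f · D) hD fun α β h =>
      h.isHom hf hhom hs.proj_ne_zero hs.isHom⟩
  · rintro α β rfl
    rcases hs.pair_mem _ hT.1 with ⟨k, hk⟩ | ⟨α', hα, β', hβ, -, h⟩
    · cases hk
    · cases h
      exact hinv (fun γ => IsBelow mo (proj f γ) _)
        (isBelow_spair (hs.proj_ne_zero α hα) (hs.proj_ne_zero β hβ))
        fun α β h => h.isBelow hs.proj_ne_zero

/-- The outcome of the treatment of `p`, with result `γ`, for the S-pair of `α` and `β`. -/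
theorem Invariant.pair_done_of_result (hf : ∀ i, f i ≠ 0)
    (hhom : ∀ i, ∃ d, (f i).IsHomogeneous d) {s : State K n m} (hs : Invariant mo f le s)
    {p : Pair K n m} {γ : FreeMod K n m} (hp : Reduces mo f le s p γ)
    {α β : FreeMod K n m} (hα : α ∈ s.G) (hβ : β ∈ s.G) {S U : ModMon n m}
    (hS : HasSig mo f (cofactor mo f α β • α) S) (hU : HasSig mo f (cofactor mo f β α • β) U)
    (h : key mo f U < key mo f S) :
    Pair.spair α β ∈ s.P \ {p} ∨ Pair.spair β α ∈ s.P \ {p} ∨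
      Rewritable mo f le s.G s.H α S ∨ Rewritable mo f le s.G s.H β U ∨
      (∃ γ ∈ s.G ∪ s.H, HasSig mo f γ S ∧ (γ ∈ s.H ∨
        mo.degree (proj f γ) ≺[mo] mo.degree (proj f α) ⊔ mo.degree (proj f β))) ∨
      (HasSig mo f γ S ∧ (proj f γ ≠ 0 →
        mo.degree (proj f γ) ≺[mo] mo.degree (proj f α) ⊔ mo.degree (proj f β))) := by
  obtain ⟨T, hT, -, hγT, -, hbelow⟩ := hs.exists_sig hf hhom hp
  by_cases h1 : p = Pair.spair α β
  · have hST := hT.2.1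
    rw [h1] at hST
    rw [hST.unique (hasSig_spair hS hU h)] at hγT
    exact Or.inr (Or.inr (Or.inr (Or.inr (Or.inr ⟨hγT, fun h0 =>
      hbelow α β h1 _ (mo.degree_mem_support h0)⟩))))
  by_cases h2 : p = Pair.spair β α
  · have hST := hT.2.1
    rw [h2] at hST
    rw [hST.unique (hasSig_spair_swap (hasSig_spair hS hU h))] at hγT
    refine Or.inr (Or.inr (Or.inr (Or.inr (Or.inr ⟨hγT, fun h0 => ?_⟩))))
    rw [sup_comm]
    exact hbelow β α h2 _ (mo.degree_mem_support h0)
  rcases hs.pair_done α hα β hβ S U hS hU h with h | h | h | h | h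
  · exact Or.inl ⟨h, fun h' => h1 h'.symm⟩
  · exact Or.inr (Or.inl ⟨h, fun h' => h2 h'.symm⟩)
  · exact Or.inr (Or.inr (Or.inl h))
  · exact Or.inr (Or.inr (Or.inr (Or.inl h)))
  · exact Or.inr (Or.inr (Or.inr (Or.inr (Or.inl h))))

theorem Invariant.unit_done_of_result (hf : ∀ i, f i ≠ 0)
    (hhom : ∀ i, ∃ d, (f i).IsHomogeneous d) {s : State K n m} (hs : Invariant mo f le s)
    {p : Pair K n m} {γ : FreeMod K n m} (hp : Reduces mo f le s p γ) (k : Fin m) :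
    Pair.unit k ∈ s.P \ {p} ∨ (∃ γ ∈ s.G ∪ s.H, IsRewriter mo f γ (k, 0)) ∨
      IsRewriter mo f γ (k, 0) := by
  obtain ⟨T, hT, -, hγT, -, -⟩ := hs.exists_sig hf hhom hp
  by_cases hk : p = Pair.unit k
  · have hST := hT.2.1
    rw [hk] at hST
    rw [hST.unique (hasSig_unitVec k)] at hγT
    exact Or.inr (Or.inr ⟨_, hγT, rfl, le_rfl⟩)
  · rcases hs.unit_done k with h | h
    · exact Or.inl ⟨h, fun h' => hk h'.symm⟩
    · exact Or.inr (Or.inl h)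

theorem Invariant.syzygy (hf : ∀ i, f i ≠ 0) (hhom : ∀ i, ∃ d, (f i).IsHomogeneous d)
    {s : State K n m} (hs : Invariant mo f le s) {p : Pair K n m} {γ : FreeMod K n m}
    (hp : Reduces mo f le s p γ) (h0 : proj f γ = 0) :
    Invariant mo f le { s with P := s.P \ {p}, H := s.H ∪ {γ} } where
  finite := hs.finite
  proj_ne_zero := hs.proj_ne_zero
  proj_eq_zero := by
    rintro σ (hσ | rfl)
    · exact hs.proj_eq_zero σ hσ
    · exact h0
  irreducible := hs.irreducible
  unit_done k := by
    rcases hs.unit_done_of_result hf hhom hp k with h | ⟨δ, hδ, h⟩ | h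
    · exact Or.inl h
    · exact Or.inr ⟨δ, hδ.imp_right Or.inl, h⟩
    · exact Or.inr ⟨γ, Or.inr (Or.inr rfl), h⟩
  pair_done α hα β hβ S U hS hU h := by
    rcases hs.pair_done_of_result hf hhom hp hα hβ hS hU h with
      h | h | h | h | ⟨δ, hδ, h, h'⟩ | ⟨h, -⟩
    · exact Or.inl h
    · exact Or.inr (Or.inl h)
    · exact Or.inr (Or.inr (Or.inl (h.mono subset_rfl Set.subset_union_left)))
    · exact Or.inr (Or.inr (Or.inr (Or.inl (h.mono subset_rfl Set.subset_union_left))))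
    · exact Or.inr (Or.inr (Or.inr (Or.inr
        ⟨δ, hδ.imp_right Or.inl, h, h'.imp_left Or.inl⟩)))
    · exact Or.inr (Or.inr (Or.inr (Or.inr
        ⟨γ, Or.inr (Or.inr rfl), h, Or.inl (Or.inr rfl)⟩)))
  isHom := hs.isHom
  pair_mem q hq := hs.pair_mem q hq.1
  le_pair q hq := hs.le_pair q hq.1
  deg_le q hq := hs.deg_le q hq.1
  koszul α hα S hS hd k hk := Or.inl (hs.koszul α hα S hS hd k hk)

/-- The regular S-pairs of a new basis element have larger signatures. -/
theorem key_lt_of_spair (hf : ∀ i, f i ≠ 0) {G : Set (FreeMod K n m)} {T : ModMon n m}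
    {γ : FreeMod K n m} (hT : HasSig mo f γ T)
    (hirr : ∀ V, IsMultiple mo f G (mo.degree (proj f γ)) V → key mo f T ≤ key mo f V)
    {α : FreeMod K n m} (hα : α ∈ G) (h : IsRegularPair mo f α γ) {U : ModMon n m}
    (hU : HasSig mo f ((Pair.spair α γ).value mo f) U) : key mo f T < key mo f U := by
  obtain ⟨S, T', hS, hT', hS', hγ', hne⟩ := exists_hasSig_cofactor hf h
  obtain rfl := hT.unique hT'
  rcases lt_or_gt_of_ne ((key_injective (mo := mo) (f := f)).ne hne) with hlt | hgt
  · rw [hU.unique (hasSig_spair_swap (hasSig_spair hγ' hS' hlt))]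
    -- Equality would make the cofactor of `γ` trivial, and the multiple of `α` would then be a
    -- regular reducer of the irreducible `γ`.
    refine lt_of_le_of_ne (key_le_shift hf _ _) fun h' => ?_
    have h0 : cofactorExp mo f γ α = 0 := by
      have h2 := congrArg Prod.snd (key_injective h')
      simpa [shift] using h2
    refine (hirr _ ⟨α, hα, S, cofactorExp mo f α γ, hS, ?_, rfl⟩).not_gt (h' ▸ hlt)
    rw [cofactorExp_add, ← cofactorExp_add', h0, zero_add]
  · rw [hU.unique (hasSig_spair hS' hγ' hgt)]
    exact (key_le_shift hf _ _).trans_lt hgt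

/-- Signatures are treated in nondecreasing order: `T` bounds the signatures of the new basis from
above (`hleT`) and those of the new pair set from below (`hTle`). -/
theorem Invariant.basis (hf : ∀ i, f i ≠ 0) (hhom : ∀ i, ∃ d, (f i).IsHomogeneous d)
    {s : State K n m} (hs : Invariant mo f le s) {p : Pair K n m} {γ : FreeMod K n m}
    (hp : Reduces mo f le s p γ) (h0 : proj f γ ≠ 0) :
    Invariant mo f le
      { s with
        P := (s.P \ {p}) ∪ {q | ∃ α ∈ s.G, IsRegularPair mo f α γ ∧ q = Pair.spair α γ}
        G := s.G ∪ {γ} } := by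
  obtain ⟨T, hT, hdeg, hγT, hhomγ, -⟩ := hs.exists_sig hf hhom hp
  have hirr : ∀ V, IsMultiple mo f s.G (mo.degree (proj f γ)) V → key mo f T ≤ key mo f V :=
    fun V hV => hp.2.2.key_le hf hs.proj_ne_zero hγT h0 hV
  have hleT : ∀ α ∈ s.G ∪ {γ}, ∀ S, HasSig mo f α S → key mo f S ≤ key mo f T := by
    rintro α (hα | rfl) S hS
    · exact hs.le_pair p hT.1 T hT.2.1 α hα S hS
    · rw [hS.unique hγT]
  have hTle : ∀ q ∈ (s.P \ {p}) ∪ {q | ∃ α ∈ s.G, IsRegularPair mo f α γ ∧ q = Pair.spair α γ},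
      ∀ U, HasSig mo f (q.value mo f) U → key mo f T ≤ key mo f U := by
    rintro q (hq | ⟨α, hα, hreg, rfl⟩) U hU
    · refine not_lt.1 ?_
      rw [← dPotLT_iff]
      exact hT.2.2 q hq.1 U hU
    · exact (key_lt_of_spair hf hγT hirr hα hreg hU).le
  refine
    { finite := hs.finite.union (Set.finite_singleton γ)
      proj_ne_zero := ?_
      proj_eq_zero := hs.proj_eq_zero
      irreducible := ?_
      unit_done := fun k => ?_
      pair_done := ?_
      isHom := ?_
      pair_mem := ?_
      le_pair := fun q hq U hU α hα S hS => (hleT α hα S hS).trans (hTle q hq U hU)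
      deg_le := fun q hq U hU =>
        hdeg.symm.le.trans (sigDegree_le_of_key_le (hTle q hq U hU))
      koszul := ?_ }
  · rintro α (hα | rfl)
    · exact hs.proj_ne_zero α hα
    · exact h0
  · rintro α hα S hS V ⟨β, hβ | rfl, R, w, hR, hw, rfl⟩
    · have hm : IsMultiple mo f s.G (mo.degree (proj f α)) (shift w R) :=
        ⟨β, hβ, R, w, hR, hw, rfl⟩
      rcases hα with hα | rfl
      · exact hs.irreducible α hα S hS _ hm
      · rw [hS.unique hγT]
        exact hirr _ hm
    -- Multiples of the new element have signature at least `T`, so they reduce no basis element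
    -- regularly.
    · rw [hR.unique hγT]
      exact (hleT α hα S hS).trans (key_le_shift hf _ _)
  · rcases hs.unit_done_of_result hf hhom hp k with h | ⟨δ, hδ, h⟩ | h
    · exact Or.inl (Or.inl h)
    · exact Or.inr ⟨δ, hδ.imp_left Or.inl, h⟩
    · exact Or.inr ⟨γ, Or.inl (Or.inr rfl), h⟩
  · rintro α hα β hβ S U hS hU h
    rcases hα with hα | rfl
    · rcases hβ with hβ | rfl
      · rcases hs.pair_done_of_result hf hhom hp hα hβ hS hU h with
          h | h | h | h | ⟨δ, hδ, h, h'⟩ | ⟨h, h'⟩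
        · exact Or.inl (Or.inl h)
        · exact Or.inr (Or.inl (Or.inl h))
        · exact Or.inr (Or.inr (Or.inl (h.mono Set.subset_union_left subset_rfl)))
        · exact Or.inr (Or.inr (Or.inr (Or.inl (h.mono Set.subset_union_left subset_rfl))))
        · exact Or.inr (Or.inr (Or.inr (Or.inr ⟨δ, hδ.imp_left Or.inl, h, h'⟩)))
        · exact Or.inr (Or.inr (Or.inr (Or.inr
            ⟨γ, Or.inl (Or.inr rfl), h, Or.inr (h' h0)⟩)))
      · exact Or.inl (Or.inr ⟨α, hα, ⟨S, U, hS, hU, fun h' => h.ne (h' ▸ rfl)⟩, rfl⟩)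
    · rcases hβ with hβ | rfl
      · exact Or.inr (Or.inl (Or.inr
          ⟨β, hβ, ⟨U, S, hU, hS, fun h' => h.ne (h' ▸ rfl)⟩, rfl⟩))
      -- The pair of the new element with itself has equal generators.
      · exact absurd h (hS.unique hU ▸ lt_irrefl _)
  · rintro α (hα | rfl)
    · exact hs.isHom α hα
    · exact hhomγ
  · rintro q (hq | ⟨α, hα, hreg, rfl⟩)
    · refine (hs.pair_mem q hq.1).imp_right ?_
      rintro ⟨α, hα, β, hβ, h⟩
      exact ⟨α, Or.inl hα, β, Or.inl hβ, h⟩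
    · exact Or.inr ⟨α, Or.inl hα, γ, Or.inr rfl, hreg, rfl⟩
  · rintro α (hα | rfl) S hS hd k hk
    · exact hs.koszul α hα S hS hd k hk
    -- The new element has exactly the current degree, so its Koszul syzygies are not yet required.
    · rw [hS.unique hγT, hdeg] at hd
      exact absurd hd (lt_irrefl _)

theorem Invariant.of_step (hf : ∀ i, f i ≠ 0) (hhom : ∀ i, ∃ d, (f i).IsHomogeneous d)
    {s s' : State K n m} (hs : Invariant mo f le s) (h : Step mo f le s s') :
    Invariant mo f le s' := by
  cases h with
  | newDegree p T hp hd => exact hs.newDegree hp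
  | discard p T hp hd hr => exact hs.discard hr
  | syzygy p γ hp h0 => exact hs.syzygy hf hhom hp h0
  | basis p γ hp h0 => exact hs.basis hf hhom hp h0

theorem IsRun.invariant (hf : ∀ i, f i ≠ 0) (hhom : ∀ i, ∃ d, (f i).IsHomogeneous d)
    {N : ℕ} {s : ℕ → State K n m} (h : IsRun mo f le N s) :
    ∀ i ≤ N, Invariant mo f le (s i) := by
  intro i
  induction i with
  | zero =>
    intro _
    rw [h.init]
    exact invariant_initState
  | succ i ih => exact fun hi => (ih (by omega)).of_step hf hhom (h.step i (by omega))

/-! ### Regular sequences of homogeneous polynomials -/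

theorem mem_span_of_mul_mem_span
    (hreg : RingTheory.Sequence.IsRegular (MvPolynomial (Fin n) K) (List.ofFn f)) (k : Fin m)
    {g : MvPolynomial (Fin n) K} (h : g * f k ∈ Ideal.span (f '' {i | i < k})) :
    g ∈ Ideal.span (f '' {i | i < k}) := by
  have hlen : (k : ℕ) < (List.ofFn f).length := by simp
  have hk := hreg.regular_mod_prev k hlen
  have hspan : (Ideal.ofList ((List.ofFn f).take k) • ⊤ :
      Submodule (MvPolynomial (Fin n) K) (MvPolynomial (Fin n) K)) =
      Ideal.span (f '' {i | i < k}) := by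
    rw [smul_eq_mul, Ideal.mul_top, Ideal.ofList]
    congr 1
    ext p
    simp only [Set.mem_ofPred_eq, List.mem_take_iff_getElem, List.length_ofFn, List.getElem_ofFn,
      Set.mem_image]
    constructor
    · rintro ⟨i, hi, rfl⟩
      exact ⟨⟨i, by omega⟩, Fin.lt_def.2 (by simp; omega), rfl⟩
    · rintro ⟨i, hi, rfl⟩
      exact ⟨i, by have := Fin.lt_def.1 hi; omega, rfl⟩
  rw [hspan] at hk
  rw [List.getElem_ofFn] at hk
  have h0 : (f k) • (Submodule.Quotient.mk g :
      MvPolynomial (Fin n) K ⧸ Ideal.span (f '' {i | i < k})) = 0 := by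
    rw [← Submodule.Quotient.mk_smul, Submodule.Quotient.mk_eq_zero, smul_eq_mul, mul_comm]
    exact h
  exact (Submodule.Quotient.mk_eq_zero _).1 (hk.right_eq_zero_of_smul h0)

theorem span_range_ne_top
    (hreg : RingTheory.Sequence.IsRegular (MvPolynomial (Fin n) K) (List.ofFn f)) :
    Ideal.span (Set.range f) ≠ ⊤ := by
  have h := hreg.top_ne_smul
  rw [smul_eq_mul, Ideal.mul_top, Ideal.ofList] at h
  intro h'
  refine h (h'.symm.trans ?_)
  congr 1
  ext p
  simp [List.mem_ofFn]

/-- Zero is a non-zero-divisor only modulo the unit ideal, which is excluded by properness. -/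
theorem ne_zero_of_isRegular
    (hreg : RingTheory.Sequence.IsRegular (MvPolynomial (Fin n) K) (List.ofFn f)) (k : Fin m) :
    f k ≠ 0 := by
  intro h0
  have h1 : (1 : MvPolynomial (Fin n) K) ∈ Ideal.span (f '' {i | i < k}) :=
    mem_span_of_mul_mem_span hreg k (by rw [h0, mul_zero]; exact Ideal.zero_mem _)
  exact span_range_ne_top hreg ((Ideal.eq_top_iff_one _).2
    (Ideal.span_mono (Set.image_subset_range _ _) h1))

/-- A nonzero constant would generate the unit ideal. -/
theorem totalDegree_pos_of_isRegular
    (hreg : RingTheory.Sequence.IsRegular (MvPolynomial (Fin n) K) (List.ofFn f)) (k : Fin m) :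
    0 < (f k).totalDegree := by
  refine Nat.pos_of_ne_zero fun h0 => span_range_ne_top hreg ?_
  have hC := totalDegree_eq_zero_iff_eq_C.1 h0
  refine Ideal.eq_top_of_isUnit_mem _ (Ideal.subset_span ⟨k, rfl⟩) ?_
  rw [hC]
  refine IsUnit.map C (isUnit_iff_ne_zero.2 fun h => ne_zero_of_isRegular hreg k ?_)
  rw [hC, h, C_0]

/-! ### Homogeneous preimages of ideal elements -/

theorem exists_proj_eq_of_mem_span {k : Fin m} {g : MvPolynomial (Fin n) K}
    (hg : g ∈ Ideal.span (f '' {i | i < k})) :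
    ∃ α : FreeMod K n m, (∀ i, α i ≠ 0 → i < k) ∧ proj f α = g := by
  induction hg using Submodule.span_induction with
  | mem p hp =>
    obtain ⟨i, hi, rfl⟩ := hp
    refine ⟨unitVec i, fun j hj => ?_, proj_unitVec i⟩
    have hji : j = i := by
      by_contra h
      exact hj (by simp [unitVec, h])
    rw [hji]
    exact hi
  | zero => exact ⟨0, fun i hi => absurd rfl hi, proj_zero⟩
  | add p q _ _ hp hq =>
    obtain ⟨α, hα, rfl⟩ := hp
    obtain ⟨β, hβ, rfl⟩ := hq
    refine ⟨α + β, fun i hi => ?_, by simp [proj, add_mul, Finset.sum_add_distrib]⟩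
    by_cases h : α i = 0
    · exact hβ i fun h' => hi (by simp [h, h'])
    · exact hα i h
  | smul p q _ hq =>
    obtain ⟨α, hα, rfl⟩ := hq
    exact ⟨p • α, fun i hi => hα i fun h => hi (by simp [h]), proj_smul p α⟩

theorem homogeneousComponent_mul_of_isHomogeneous {p q : MvPolynomial (Fin n) K} {d : ℕ}
    (hq : q.IsHomogeneous d) (E : ℕ) :
    homogeneousComponent E (p * q) =
      if d ≤ E then homogeneousComponent (E - d) p * q else 0 := by
  have hsum : p * q = ∑ j ∈ Finset.range (p.totalDegree + 1), homogeneousComponent j p * q := by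
    rw [← Finset.sum_mul, sum_homogeneousComponent]
  have hcomp : ∀ j, homogeneousComponent E (homogeneousComponent j p * q) =
      if j + d = E then homogeneousComponent j p * q else 0 := by
    intro j
    rw [homogeneousComponent_of_mem (n := j + d)
      ((homogeneousComponent_isHomogeneous j p).mul hq)]
    simp only [eq_comm]
  rw [hsum, map_sum, Finset.sum_congr rfl fun j _ => hcomp j]
  split_ifs with hE
  · have hj : ∀ j, j + d = E ↔ E - d = j := fun j => by omega
    simp only [hj, Finset.sum_ite_eq, Finset.mem_range]
    split_ifs with h
    · rfl
    · rw [homogeneousComponent_eq_zero _ _ (by omega), zero_mul]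
  · exact Finset.sum_eq_zero fun j _ => if_neg (by omega)

/-- A homogeneous polynomial in the ideal generated by `f_i`, `i < k`, is the image of a
homogeneous element of the free module. -/
theorem exists_isHom_proj_eq (hf : ∀ i, f i ≠ 0) (hhom : ∀ i, ∃ d, (f i).IsHomogeneous d)
    {k : Fin m} {g : MvPolynomial (Fin n) K} (hg : g ∈ Ideal.span (f '' {i | i < k})) {E : ℕ}
    (hgE : g.IsHomogeneous E) :
    ∃ α : FreeMod K n m, (∀ i, α i ≠ 0 → i < k) ∧ IsHom f α E ∧ proj f α = g := by
  obtain ⟨β, hβ, hβg⟩ := exists_proj_eq_of_mem_span hg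
  have hd : ∀ i, (f i).IsHomogeneous (f i).totalDegree := fun i => by
    obtain ⟨d, hd⟩ := hhom i
    rwa [hd.totalDegree (hf i)]
  -- From each coefficient only the component contributing to degree `E` is kept. The condition
  -- guards the truncated subtraction: a generator of degree above `E` contributes nothing.
  refine ⟨fun i => if (f i).totalDegree ≤ E then
    homogeneousComponent (E - (f i).totalDegree) (β i) else 0, fun i hi => hβ i fun h => hi ?_,
    ?_, ?_⟩
  · simp [h]
  · rintro ⟨i, a⟩ ha
    dsimp only at ha
    split_ifs at ha with h
    · rw [coeff_homogeneousComponent] at ha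
      split_ifs at ha with h'
      · rw [sigDegree_eq hf]
        show a.degree + (f i).totalDegree = E
        omega
      · exact absurd rfl ha
    · exact absurd rfl ha
  · rw [← homogeneousComponent_eq_self hgE, ← hβg, proj, proj, map_sum]
    refine Finset.sum_congr rfl fun i _ => ?_
    rw [homogeneousComponent_mul_of_isHomogeneous (hd i), ite_mul, zero_mul]

/-! ### No s-reduction to zero -/

/-- The leading exponent of the component at the index of a homogeneous element. -/
theorem IsHom.degree_apply_eq {γ : FreeMod K n m} {D : ℕ}
    (h : IsHom f γ D) {T : ModMon n m} (hT : HasSig mo f γ T) : mo.degree (γ T.1) = T.2 := by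
  have h0 : γ T.1 ≠ 0 := fun h0 => hT.1 (by rw [h0, coeff_zero])
  have hmem := mem_support_iff.1 (mo.degree_mem_support h0)
  refine mo.toSyn.injective (le_antisymm ?_ (mo.le_degree (mem_support_iff.2 hT.1)))
  by_contra! hlt
  have hne : (T.1, mo.degree (γ T.1)) ≠ T := fun he => hlt.ne' (by rw [← he])
  rcases hT.2 (T.1, mo.degree (γ T.1)) hmem hne with h' | ⟨-, h' | h'⟩
  · rw [h (T.1, mo.degree (γ T.1)) hmem, h T hT.1] at h'
    exact lt_irrefl _ h'
  · exact lt_irrefl _ h'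
  · exact hlt.not_gt h'.2

/-- All terms of the syzygy have the same degree, so position `k` wins; `α` has no component there,
and the coefficient of e_k is the image of `α`. -/
theorem hasSig_koszul (hf : ∀ i, f i ≠ 0) (hhom : ∀ i, ∃ d, (f i).IsHomogeneous d)
    {α : FreeMod K n m} {D : ℕ} (hα : IsHom f α D) {S : ModMon n m} (hS : HasSig mo f α S)
    (h0 : proj f α ≠ 0) {k : Fin m} (hk : S.1 < k) :
    HasSig mo f (proj f α • unitVec k - f k • α) (k, mo.degree (proj f α)) := by
  have hindex : ∀ j, α j ≠ 0 → j < k := fun j hj => by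
    obtain ⟨a, ha⟩ := MvPolynomial.ne_zero_iff.1 hj
    exact (hα.index_le hS (U := (j, a)) ha).trans_lt hk
  have hαk : α k = 0 := by
    by_contra h
    exact lt_irrefl _ (hindex k h)
  have hp : ∀ a ∈ (proj f α).support, sigDegree f (k, a) = D + (f k).totalDegree :=
    fun a ha => by rw [sigDegree_eq hf, hα.degree_eq_of_mem_support hf hhom ha]
  have hmem := mo.degree_mem_support h0
  constructor
  · simpa [unitVec, hαk] using h0
  · rintro ⟨j, a⟩ hU hne
    by_cases hj : j = k
    · subst hj
      simp only [Pi.sub_apply, Pi.smul_apply, unitVec, Pi.single_eq_same, smul_eq_mul, mul_one,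
        hαk, mul_zero, sub_zero] at hU
      have ha := mem_support_iff.2 hU
      refine Or.inr ⟨(hp a ha).trans (hp _ hmem).symm, Or.inr ⟨rfl, ?_⟩⟩
      exact lt_of_le_of_ne (mo.le_degree ha) fun h => hne (Prod.ext rfl (mo.toSyn.injective h))
    · simp only [Pi.sub_apply, Pi.smul_apply, unitVec, Pi.single_eq_of_ne hj, smul_eq_mul,
        mul_zero, zero_sub, coeff_neg, neg_ne_zero] at hU
      have hj0 : α j ≠ 0 := fun h => hU (by rw [h, mul_zero, coeff_zero])
      have hhom' : (α j * f j * f k).IsHomogeneous (D + (f k).totalDegree) := by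
        obtain ⟨d, hd⟩ := hhom k
        rw [hd.totalDegree (hf k)]
        exact (hα.isHomogeneous_mul hf hhom j).mul hd
      have hdeg : a.degree + (f j).totalDegree = D + (f k).totalDegree := by
        obtain ⟨d, hd⟩ := hhom j
        have hfk : (f k * α j).IsHomogeneous ((f k * α j).totalDegree) := by
          obtain ⟨b, hb⟩ := MvPolynomial.ne_zero_iff.1 hj0
          obtain ⟨e, he⟩ := hhom k
          have h := he.mul (hα.isHomogeneous_apply hf hb)
          rwa [h.totalDegree (mul_ne_zero (hf k) hj0)]
        have hne0 : f k * α j ≠ 0 := mul_ne_zero (hf k) hj0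
        have h1 : a.degree = (f k * α j).totalDegree := by
          by_contra h
          exact hU (hfk.coeff_eq_zero h)
        have h2 := hhom'.totalDegree (by
          rw [mul_assoc]
          exact mul_ne_zero hj0 (mul_ne_zero (hf j) (hf k)))
        rw [h1, ← totalDegree_mul_of_isDomain hne0 (hf j), ← h2]
        congr 1
        ring
      refine Or.inr ⟨?_, Or.inl (hindex j hj0)⟩
      rw [hp _ hmem, sigDegree_eq hf]
      exact hdeg

/-- The signature of a regular S-pair is that of its larger generator, and the syzygy makes this
generator rewritable. -/
theorem Invariant.isRewritable_of_syzygy (hf : ∀ i, f i ≠ 0) {s : State K n m}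
    (hs : Invariant mo f le s) (hle : IsAdmissibleOrder mo f le s.G s.H) {p : Pair K n m}
    (hp : p ∈ s.P) {T : ModMon n m} (hT : HasSig mo f (p.value mo f) T)
    {σ : FreeMod K n m} (hσ : σ ∈ s.H) (hσT : IsRewriter mo f σ T) :
    p.IsRewritable mo f le s.G s.H := by
  rcases hs.pair_mem p hp with ⟨k, rfl⟩ | ⟨α, hα, β, hβ, hreg, rfl⟩
  · rw [hT.unique (hasSig_unitVec k)] at hσT
    exact ⟨σ, Or.inr hσ, hσT⟩
  · obtain ⟨S, U, -, -, hS, hU, hne⟩ := exists_hasSig_cofactor hf hreg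
    rcases lt_or_gt_of_ne ((key_injective (mo := mo) (f := f)).ne hne) with hlt | hgt
    · obtain rfl := hT.unique (hasSig_spair_swap (hasSig_spair hU hS hlt))
      exact Or.inr ⟨_, hU, rewritable_of_syzygy hs.toBasisInvariant hle hβ hσ hσT⟩
    · obtain rfl := hT.unique (hasSig_spair hS hU hgt)
      exact Or.inl ⟨_, hS, rewritable_of_syzygy hs.toBasisInvariant hle hα hσ hσT⟩

theorem Invariant.proj_ne_zero_of_reduces
    (hhom : ∀ i, ∃ d, (f i).IsHomogeneous d)
    (hreg : RingTheory.Sequence.IsRegular (MvPolynomial (Fin n) K) (List.ofFn f))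
    {s : State K n m} (hs : Invariant mo f le s) (hle : IsAdmissibleOrder mo f le s.G s.H)
    {p : Pair K n m} {γ : FreeMod K n m} (hp : Reduces mo f le s p γ) : proj f γ ≠ 0 := by
  have hf := ne_zero_of_isRegular hreg
  intro h0
  obtain ⟨T, hT, hdeg, hγT, ⟨D, hD⟩, -⟩ := hs.exists_sig hf hhom hp
  have hDT : sigDegree f T = D := hD T hγT.1
  have hγ0 : γ T.1 ≠ 0 := fun h => hγT.1 (by rw [h, coeff_zero])
  -- The vanishing image is solved for the component at the index of `γ`; by homogeneity the other
  -- nonzero components have smaller index.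
  have hmem : γ T.1 * f T.1 ∈ Ideal.span (f '' {i | i < T.1}) := by
    have hsum : γ T.1 * f T.1 = -∑ i ∈ Finset.univ.erase T.1, γ i * f i := by
      rw [eq_neg_iff_add_eq_zero, Finset.add_sum_erase _ (fun i => γ i * f i) (Finset.mem_univ _)]
      exact h0
    rw [hsum]
    refine neg_mem (Ideal.sum_mem _ fun i hi => ?_)
    by_cases hγi : γ i = 0
    · rw [hγi, zero_mul]
      exact Ideal.zero_mem _
    · obtain ⟨a, ha⟩ := MvPolynomial.ne_zero_iff.1 hγi
      exact Ideal.mul_mem_left _ _ (Ideal.subset_span ⟨i, lt_of_le_of_ne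
        (hD.index_le hγT (U := (i, a)) ha) (Finset.ne_of_mem_erase hi), rfl⟩)
  have hhomγ : (γ T.1).IsHomogeneous T.2.degree := hD.isHomogeneous_apply hf hγT.1
  obtain ⟨α, hα, hαE, hαγ⟩ := exists_isHom_proj_eq hf hhom
    (mem_span_of_mul_mem_span hreg T.1 hmem) hhomγ
  -- The component of `γ` has the current degree minus the positive degree of its generator, which
  -- puts its preimage `α` in an earlier degree.
  have hlt : T.2.degree < s.deg := by
    have := totalDegree_pos_of_isRegular hreg T.1
    rw [← hdeg, sigDegree_eq hf]
    omega
  obtain ⟨U, hU⟩ := exists_hasSig mo f (α := α) (by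
    rintro rfl
    rw [proj_zero] at hαγ
    exact hγ0 hαγ.symm)
  have hUk : U.1 < T.1 := hα _ fun h => hU.1 (by rw [h, coeff_zero])
  have hUE : sigDegree f U = T.2.degree := hαE U hU.1
  have htreated : Treated mo f s U := by
    intro q hq V hV
    refine Prod.Lex.toLex_lt_toLex.2 (Or.inl ?_)
    have := hs.deg_le q hq V hV
    show sigDegree f U < sigDegree f V
    omega
  obtain ⟨V, hVU, β, hβ, S, w, hS, hw, rfl⟩ := reducibleAt hf hs.toBasisInvariant hle U htreated
    α hU (by rwa [hαγ])
  -- The image of `α` is γ_k, so the lead monomial of the image of `β` divides the monomial of `T`.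
  rw [hαγ, hD.degree_apply_eq hγT] at hw
  obtain ⟨E, hE⟩ := hs.isHom β hβ
  have hβ0 := hs.proj_ne_zero β hβ
  have hdegβ := hE.degree_eq_of_mem_support hf hhom (mo.degree_mem_support hβ0)
  have hsum : w.degree + E = T.2.degree := by rw [← hw, map_add, hdegβ]
  have hSE := hE S hS.1
  -- The multiple of `β` has the same degree as `U`, so its signature being at most `U` bounds its
  -- index by that of `U`.
  have hSk : S.1 < T.1 := by
    refine lt_of_le_of_lt ?_ hUk
    rcases hVU.eq_or_lt with h | h
    · rw [← key_injective h]
      rfl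
    · rcases dPotLT_iff.2 h with h | ⟨-, h | h⟩
      · rw [sigDegree_shift hf] at h
        omega
      · exact h.le
      · exact h.1.le
  exact hp.2.1 (hs.isRewritable_of_syzygy hf hle hT.1 hT.2.1
    (hs.koszul β hβ S hS (by omega) T.1 hSk)
    ⟨_, hasSig_koszul hf hhom hE hS hβ0 hSk, rfl, hw ▸ le_add_self⟩)

end SigGB

theorem mainTheorem3 {K : Type*} [Field K] {n m : ℕ} (mo : MonomialOrder (Fin n))
    (f : Fin m → MvPolynomial (Fin n) K)
    (hhom : ∀ i, ∃ d, (f i).IsHomogeneous d)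
    (hreg : RingTheory.Sequence.IsRegular (MvPolynomial (Fin n) K) (List.ofFn f))
    (le : SigGB.FreeMod K n m → SigGB.FreeMod K n m → Prop)
    (N : ℕ) (s : ℕ → SigGB.State K n m) (hrun : SigGB.IsRun mo f le N s) :
    ∀ i ≤ N, ∀ (p : SigGB.Pair K n m) (γ : SigGB.FreeMod K n m),
      SigGB.Reduces mo f le (s i) p γ → SigGB.proj f γ ≠ 0 := by
  intro i hi p γ hp
  exact (hrun.invariant (SigGB.ne_zero_of_isRegular hreg) hhom i hi).proj_ne_zero_of_reduces
    hhom hreg (hrun.order i hi) hp
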